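/- Let $(M,g)$ be a compact smooth Riemannian manifold with boundary and let $\mathcal F$ be a smooth codimension-one foliation of $M$ such that every connected component of $\partial M$ is either tangent or transverse to $\mathcal F$. Write $d$ for the Riemannian distance (with $d=\infty$ between different components of $M$). For leaves $L,L'$ put $$\rho(L,L')=\inf\sum_{i=1}^{n-1}\operatorname{dist}(L_i,L_{i+1}),$$ the infimum being over all finite sequences of leaves with $L_1=L$, $L_n=L'$. The Hausdorff leaf space $\mathrm{HLS}(\mathcal F)$ is the set of leaves with leaves at $\rho$-distance $0$ identified, with the metric induced by $\rho$; $\pi:M\to\mathrm{HLS}(\mathcal F)$ is the natural projection. Let $S$ be a connected component of $\partial M$ that is transverse to $\mathcal F$, and suppose that $\mathcal F|S$ is defined by a closed nonsingular smooth $1$-form $\omega$ on $S$. Let $N(S)\cong S\times[0,1)$ be a foliated collar of $S=S\times\{0\}$, i.e. the leaves of $\mathcal F|N(S)$ are of the form $L\times[0,1)$ with $L$ a leaf of $\mathcal F|S$; let $t$ be the coordinate on $[0,1)$ and extend $\omega$ to $N(S)$ by pulling it back under the projection $N(S)\to S$. Let $h:[0,1)\to[0,1]$ be a $C^\infty$ function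 with $h(0)=1$, strictly decreasing on $[0,\frac12]$, zero on $[\frac12,1)$, and with all derivatives of order $\ge 1$ vanishing at $0$. Put $\theta=(1-h(t))\,\omega+h(t)\,dt$ on $N(S)$. Then the hyperplane field that equals $\ker\theta$ on $N(S)$ and $T\mathcal F$ on $M\setminus N(S)$ is the tangent field of a smooth codimension-one foliation $\mathcal F_S$ of $M$, each component of $\partial M$ being again tangent or transverse to $\mathcal F_S$ (the spun foliation). Let $X$ be the space obtained from $\mathrm{HLS}(\mathcal F)$ by collapsing $\pi(S)$ to a point, with the quotient metric $d_X$ (infimum of $\sum_i \rho(p_i,q_i)$ over finite chains in which $q_i$ and $p_{i+1}$ are equal or both in $\pi(S)$), and let $\phi:\mathrm{HLS}(\mathcal F)\to X$ and $\pi_S:M\to\mathrm{HLS}(\mathcal F_S)$ be the natural projections. Then $\mathrm{HLS}(\mathcal F_S)$ is isometric to $(X,d_X)$, by an isometry $e:X\to\mathrm{HLS}(\mathcal F_S)$ with $e(\phi(\pi(x)))=\pi_S(x)$ for all $x\in M$. -/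

import Mathlib

open Set Manifold Bundle
open scoped ContDiff Topology ENNReal

noncomputable section

namespace HausdorffLeaf

/-! ### Chains and quotient (pseudo)metrics -/

/-- The distance `inf {d x y | x ∈ a, y ∈ b}` between two equivalence classes. -/
def classDist {X : Type*} (d : X → X → ℝ≥0∞) (r : Setoid X) (a b : Quotient r) : ℝ≥0∞ :=
  ⨅ (x : X) (_ : Quotient.mk r x = a) (y : X) (_ : Quotient.mk r y = b), d x y

/-- The infimum of `∑ δ (cᵢ, cᵢ₊₁)` over all finite sequences `c₀ = a, c₁, …, cₙ = b`. -/
def chainDist {Y : Type*} (δ : Y → Y → ℝ≥0∞) (a b : Y) : ℝ≥0∞ :=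
  ⨅ (n : ℕ) (c : ℕ → Y) (_ : c 0 = a) (_ : c n = b), ∑ i ∈ Finset.range n, δ (c i) (c (i + 1))

theorem classDist_comm {X : Type*} {d : X → X → ℝ≥0∞} (hd : ∀ x y, d x y = d y x)
    (r : Setoid X) (a b : Quotient r) : classDist d r a b = classDist d r b a := by
  have key : ∀ a b : Quotient r, classDist d r a b ≤ classDist d r b a := by
    intro a b
    refine le_iInf fun y => le_iInf fun hy => le_iInf fun x => le_iInf fun hx => ?_
    rw [hd y x]
    exact iInf_le_of_le x (iInf_le_of_le hx (iInf_le_of_le y (iInf_le_of_le hy le_rfl)))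
  exact le_antisymm (key a b) (key b a)

theorem chainDist_le {Y : Type*} (δ : Y → Y → ℝ≥0∞) {a b : Y} (n : ℕ) (c : ℕ → Y)
    (h0 : c 0 = a) (hn : c n = b) :
    chainDist δ a b ≤ ∑ i ∈ Finset.range n, δ (c i) (c (i + 1)) :=
  iInf_le_of_le n (iInf_le_of_le c (iInf_le_of_le h0 (iInf_le_of_le hn le_rfl)))

theorem chainDist_self {Y : Type*} (δ : Y → Y → ℝ≥0∞) (a : Y) : chainDist δ a a = 0 :=
  le_antisymm (by simpa using chainDist_le δ 0 (fun _ => a) rfl rfl) bot_le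

theorem chainDist_comm {Y : Type*} {δ : Y → Y → ℝ≥0∞} (hδ : ∀ a b, δ a b = δ b a) (a b : Y) :
    chainDist δ a b = chainDist δ b a := by
  have key : ∀ a b : Y, chainDist δ a b ≤ chainDist δ b a := by
    intro a b
    refine le_iInf fun n => le_iInf fun c => le_iInf fun h0 => le_iInf fun hn => ?_
    refine (chainDist_le δ n (fun i => c (n - i)) (by simpa using hn) (by simpa using h0)).trans ?_
    rw [← Finset.sum_range_reflect]
    refine le_of_eq (Finset.sum_congr rfl fun i hi => ?_)
    have hi' : i < n := Finset.mem_range.mp hi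
    have e1 : n - (n - 1 - i) = i + 1 := by omega
    have e2 : n - (n - 1 - i + 1) = i := by omega
    simp only [e1, e2]
    exact hδ _ _
  exact le_antisymm (key a b) (key b a)

theorem chainDist_triangle {Y : Type*} (δ : Y → Y → ℝ≥0∞) (a b c : Y) :
    chainDist δ a c ≤ chainDist δ a b + chainDist δ b c := by
  rw [chainDist, chainDist, chainDist]
  simp only [ENNReal.iInf_add, ENNReal.add_iInf]
  refine le_iInf fun k => le_iInf fun v => le_iInf fun hv0 => le_iInf fun hvk => ?_
  refine le_iInf fun n => le_iInf fun u => le_iInf fun hu0 => le_iInf fun hun => ?_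
  refine (chainDist_le δ (n + k) (fun i => if i ≤ n then u i else v (i - n))
    (by simpa using hu0) ?_).trans ?_
  · by_cases hk : k = 0
    · subst hk
      simpa [hun, ← hv0] using hvk
    · simp [hk, hvk]
  · rw [Finset.sum_range_add]
    refine add_le_add (Finset.sum_le_sum fun i hi => ?_) (Finset.sum_le_sum fun i hi => ?_)
    · have hi' : i < n := Finset.mem_range.mp hi
      simp [hi'.le, Nat.succ_le_of_lt hi']
    · by_cases h : i = 0
      · subst h
        simp [hun, hv0]
      · simp [h, Nat.add_assoc]

/-- The pseudometric given by chains. -/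
abbrev chainPseudoEMetric {Y : Type*} (δ : Y → Y → ℝ≥0∞) (hδ : ∀ a b, δ a b = δ b a) :
    PseudoEMetricSpace Y where
  edist := chainDist δ
  edist_self := chainDist_self δ
  edist_comm := chainDist_comm hδ
  edist_triangle := chainDist_triangle δ

/-- The relation identifying all points of `A` with one another (and nothing else). -/
def collapseSetoid {X : Type*} (A : Set X) : Setoid X where
  r x y := x = y ∨ (x ∈ A ∧ y ∈ A)
  iseqv :=
    { refl := fun _ => Or.inl rfl
      symm := by
        rintro x y (h | ⟨h, h'⟩)
        · exact Or.inl h.symm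
        · exact Or.inr ⟨h', h⟩
      trans := by
        rintro x y z (rfl | ⟨h, h'⟩) (rfl | ⟨k, k'⟩)
        · exact Or.inl rfl
        · exact Or.inr ⟨k, k'⟩
        · exact Or.inr ⟨h, h'⟩
        · exact Or.inr ⟨h, k'⟩ }

/-- The set `X` with `A` collapsed to a point, before points at distance zero are identified. -/
def PreCollapse (X : Type*) (A : Set X) : Type _ := Quotient (collapseSetoid A)

/-- The quotient pseudometric: `inf ∑ d(pᵢ, qᵢ)` over chains with `qᵢ` equivalent to `pᵢ₊₁`. -/
instance {X : Type*} [PseudoEMetricSpace X] (A : Set X) : PseudoEMetricSpace (PreCollapse X A) :=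
  chainPseudoEMetric (Y := Quotient (collapseSetoid A)) (classDist edist (collapseSetoid A))
    (classDist_comm edist_comm _)

/-- The space `X` with `A` collapsed to a point, with the quotient metric. -/
abbrev Collapse (X : Type*) [PseudoEMetricSpace X] (A : Set X) : Type _ :=
  SeparationQuotient (PreCollapse X A)

/-- The projection `X → Collapse X A`. -/
def Collapse.proj {X : Type*} [PseudoEMetricSpace X] (A : Set X) (x : X) : Collapse X A :=
  SeparationQuotient.mk (Quotient.mk (collapseSetoid A) x : PreCollapse X A)

/-! ### Differential 1-forms on manifolds, possibly with boundary -/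

section Forms

variable {E : Type*} [NormedAddCommGroup E] [NormedSpace ℝ E] {H : Type*} [TopologicalSpace H]
  (I : ModelWithCorners ℝ E H) {M : Type*} [TopologicalSpace M] [ChartedSpace H M]

/-- The coordinate expression of the 1-form `α` in the preferred chart at `x₀`. -/
def formInChart (α : ∀ x : M, TangentSpace I x →L[ℝ] ℝ) (x₀ : M) (y : E) : E →L[ℝ] ℝ :=
  (α ((extChartAt I x₀).symm y)).comp
    (mfderivWithin 𝓘(ℝ, E) I (extChartAt I x₀).symm (range I) y)

/-- The 1-form `α` is smooth at `x`. -/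
def SmoothFormAt (α : ∀ x : M, TangentSpace I x →L[ℝ] ℝ) (x : M) : Prop :=
  ContDiffWithinAt ℝ ∞ (formInChart I α x) (range I) (extChartAt I x x)

/-- The exterior derivative `dα(v, w) = ∂ᵥ(α w) - ∂_w(α v)` at `x`, computed in the preferred chart
at `x`, the chart through which `TangentSpace I x` is identified with `E`. -/
def extDerivForm (α : ∀ x : M, TangentSpace I x →L[ℝ] ℝ) (x : M) (v w : TangentSpace I x) : ℝ :=
  let D : E →L[ℝ] E →L[ℝ] ℝ := fderivWithin ℝ (formInChart I α x) (range I) (extChartAt I x x)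
  D (v : E) (w : E) - D (w : E) (v : E)

/-- The 1-form `α` is closed. -/
def IsClosedForm (α : ∀ x : M, TangentSpace I x →L[ℝ] ℝ) : Prop :=
  ∀ (x : M) (v w : TangentSpace I x), extDerivForm I α x v w = 0

/-- The integrability condition `α ∧ dα = 0` at `x`. -/
def FrobeniusAt (α : ∀ x : M, TangentSpace I x →L[ℝ] ℝ) (x : M) : Prop :=
  ∀ u v w : TangentSpace I x, α x u * extDerivForm I α x v w + α x v * extDerivForm I α x w u
    + α x w * extDerivForm I α x u v = 0

end Forms

/-! ### Codimension one foliations of manifolds with boundary -/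

section Foliations

/-- The tangent space of the boundary at a boundary point `x` of a manifold modelled on the
half-space `{y | 0 ≤ y 0}`, as a hyperplane in the tangent space of the manifold. -/
def boundaryTangent {m : ℕ} {M : Type*} [TopologicalSpace M]
    [ChartedSpace (EuclideanHalfSpace (m + 1)) M] (x : M) :
    Submodule ℝ (TangentSpace (𝓡∂ (m + 1)) x) :=
  LinearMap.ker (EuclideanSpace.proj (0 : Fin (m + 1)) :
    EuclideanSpace ℝ (Fin (m + 1)) →L[ℝ] ℝ).toLinearMap

/-- A smooth codimension one foliation of an `(m+1)`-manifold with boundary, given by its (smooth,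
integrable) field of tangent hyperplanes. Every component of the boundary is either tangent or
transverse to the foliation. -/
structure Foliation (m : ℕ) (M : Type*) [TopologicalSpace M]
    [ChartedSpace (EuclideanHalfSpace (m + 1)) M] where
  /-- the tangent space of the leaf through `x` -/
  tangent : ∀ x : M, Submodule ℝ (TangentSpace (𝓡∂ (m + 1)) x)
  /-- locally the field of hyperplanes is the kernel of a nonsingular smooth form `α` with
  `α ∧ dα = 0` -/
  integrable : ∀ x : M, ∃ U : Set M, IsOpen U ∧ x ∈ U ∧
    ∃ α : ∀ y : M, TangentSpace (𝓡∂ (m + 1)) y →L[ℝ] ℝ, ∀ y ∈ U,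
      SmoothFormAt (𝓡∂ (m + 1)) α y ∧ α y ≠ 0 ∧ FrobeniusAt (𝓡∂ (m + 1)) α y ∧
        ∀ v : TangentSpace (𝓡∂ (m + 1)) y, v ∈ tangent y ↔ α y v = 0
  tangent_or_transverse : ∀ x ∈ (𝓡∂ (m + 1)).boundary M,
    (∀ y ∈ connectedComponentIn ((𝓡∂ (m + 1)).boundary M) x, tangent y = boundaryTangent y) ∨
    (∀ y ∈ connectedComponentIn ((𝓡∂ (m + 1)).boundary M) x, tangent y ⊔ boundaryTangent y = ⊤)

variable {m : ℕ} {M : Type*} [TopologicalSpace M] [ChartedSpace (EuclideanHalfSpace (m + 1)) M]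

/-- There is a `C¹` curve from `x` to `y` which is everywhere tangent to the foliation. -/
def Foliation.TangentCurve (F : Foliation m M) (x y : M) : Prop :=
  ∃ γ : ℝ → M, ContMDiffOn 𝓘(ℝ, ℝ) (𝓡∂ (m + 1)) 1 γ (Icc 0 1) ∧ γ 0 = x ∧ γ 1 = y ∧
    ∀ t ∈ Icc (0 : ℝ) 1,
      mfderivWithin 𝓘(ℝ, ℝ) (𝓡∂ (m + 1)) γ (Icc 0 1) t (1 : ℝ) ∈ F.tangent (γ t)

/-- Being in the same leaf: two points are in the same leaf iff a piecewise `C¹` curve tangent to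
the foliation joins them. -/
def Foliation.leafSetoid (F : Foliation m M) : Setoid M := Relation.EqvGen.setoid F.TangentCurve

/-- The set of leaves. -/
def Foliation.LeafSpace (F : Foliation m M) : Type _ := Quotient F.leafSetoid

variable [IsManifold (𝓡∂ (m + 1)) ∞ M]
  [RiemannianBundle (fun x : M => TangentSpace (𝓡∂ (m + 1)) x)]

/-- The pseudometric `ρ(L, L') = inf ∑ dist(Lᵢ, Lᵢ₊₁)` on the set of leaves, the infimum being over
finite sequences of leaves from `L` to `L'`, with `dist` the Riemannian distance of sets. -/
instance (F : Foliation m M) : PseudoEMetricSpace F.LeafSpace :=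
  chainPseudoEMetric (Y := Quotient F.leafSetoid)
    (classDist (riemannianEDist (𝓡∂ (m + 1))) F.leafSetoid)
    (classDist_comm (fun _ _ => riemannianEDist_comm) _)

/-- The Hausdorff leaf space: leaves at `ρ`-distance zero are identified. -/
abbrev Foliation.HLS (F : Foliation m M) : Type _ := SeparationQuotient F.LeafSpace

/-- The natural projection of the manifold onto the Hausdorff leaf space. -/
def Foliation.proj (F : Foliation m M) (x : M) : F.HLS :=
  SeparationQuotient.mk (Quotient.mk F.leafSetoid x : F.LeafSpace)

end Foliations

/-! ### Spinning -/

section Spinning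

/-- A collar `S × [0, 1) ≅ N(S)` in `M` of the boundary component `S × {0}`. -/
structure Collar (m : ℕ) (S : Type*) [TopologicalSpace S]
    [ChartedSpace (EuclideanSpace ℝ (Fin m)) S] (M : Type*) [TopologicalSpace M]
    [ChartedSpace (EuclideanHalfSpace (m + 1)) M] where
  /-- the diffeomorphism of `S × [0, 1)` with the open set `N(S)` of `M` -/
  diffeo : PartialDiffeomorph ((𝓡 m).prod (𝓡∂ 1)) (𝓡∂ (m + 1)) (S × EuclideanHalfSpace 1) M ∞
  source_eq : diffeo.source = {p | p.2.val 0 < 1}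
  isComponent : ∃ x ∈ (𝓡∂ (m + 1)).boundary M,
    range (fun s : S => diffeo (s, 0)) = connectedComponentIn ((𝓡∂ (m + 1)).boundary M) x

variable {m : ℕ} {S : Type*} [TopologicalSpace S] [ChartedSpace (EuclideanSpace ℝ (Fin m)) S]
  {M : Type*} [TopologicalSpace M] [ChartedSpace (EuclideanHalfSpace (m + 1)) M]

/-- The inclusion `S → M`. -/
def Collar.incl (c : Collar m S M) (s : S) : M := c.diffeo (s, 0)

/-- The open set `N(S)`. -/
def Collar.nhd (c : Collar m S M) : Set M := c.diffeo.target

/-- The projection `N(S) = S × [0, 1) → S`. -/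
def Collar.base (c : Collar m S M) (x : M) : S := (c.diffeo.invFun x).1

/-- The coordinate `t : N(S) = S × [0, 1) → [0, 1)`. -/
def Collar.height (c : Collar m S M) (x : M) : ℝ := (c.diffeo.invFun x).2.val 0

/-- `S` is transverse to the foliation. -/
def Collar.IsTransverse (c : Collar m S M) (F : Foliation m M) : Prop :=
  ∀ s : S, F.tangent (c.incl s) ⊔ boundaryTangent (c.incl s) = ⊤

/-- The tangent spaces of the foliation `F|S` induced on `S`. -/
def Collar.restrictTangent (c : Collar m S M) (F : Foliation m M) (s : S) :
    Submodule ℝ (TangentSpace (𝓡 m) s) :=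
  (F.tangent (c.incl s)).comap (mfderiv (𝓡 m) (𝓡∂ (m + 1)) c.incl s).toLinearMap

/-- The collar is foliated: in `N(S) = S × [0, 1)` the leaves are of the form `L × [0, 1)`, with `L`
a leaf of `F|S`. -/
def Collar.IsFoliated (c : Collar m S M) (F : Foliation m M) : Prop :=
  ∀ x ∈ c.nhd, F.tangent x = (c.restrictTangent F (c.base x)).comap
    (mfderiv (𝓡∂ (m + 1)) (𝓡 m) c.base x).toLinearMap

/-- The foliation `F|S` is defined by the closed nonsingular smooth 1-form `η` on `S`. -/
structure Collar.IsDefiningForm (c : Collar m S M) (F : Foliation m M)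
    (η : ∀ s : S, TangentSpace (𝓡 m) s →L[ℝ] ℝ) : Prop where
  smooth : ∀ s, SmoothFormAt (𝓡 m) η s
  closed : IsClosedForm (𝓡 m) η
  nonsingular : ∀ s, η s ≠ 0
  mem_iff : ∀ (s : S) (v : TangentSpace (𝓡 m) s), v ∈ c.restrictTangent F s ↔ η s v = 0

/-- The functions `h : [0, 1) → [0, 1]` used for spinning. -/
structure IsSpinningFunction (h : ℝ → ℝ) : Prop where
  smooth : ContDiffOn ℝ ∞ h (Ico 0 1)
  mapsTo : MapsTo h (Ico 0 1) (Icc 0 1)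
  map_zero : h 0 = 1
  eq_zero : ∀ t ∈ Ico (1 / 2 : ℝ) 1, h t = 0
  strictAnti : StrictAntiOn h (Icc 0 (1 / 2))
  flat : ∀ k : ℕ, 1 ≤ k → iteratedDerivWithin k h (Ico 0 1) 0 = 0

/-- The form `dt` on the collar. -/
def Collar.dt (c : Collar m S M) (x : M) : TangentSpace (𝓡∂ (m + 1)) x →L[ℝ] ℝ :=
  mfderiv (𝓡∂ (m + 1)) 𝓘(ℝ, ℝ) c.height x

/-- The form `θ = (1 - h(t)) η + h(t) dt` on the collar, `η` being extended to the collar by its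
pullback under the projection to `S`. -/
def Collar.spinForm (c : Collar m S M) (η : ∀ s : S, TangentSpace (𝓡 m) s →L[ℝ] ℝ) (h : ℝ → ℝ)
    (x : M) : TangentSpace (𝓡∂ (m + 1)) x →L[ℝ] ℝ :=
  (1 - h (c.height x)) • (η (c.base x)).comp (mfderiv (𝓡∂ (m + 1)) (𝓡 m) c.base x)
    + h (c.height x) • c.dt x

open Classical in
/-- The field of hyperplanes of the spun foliation: the kernel of `θ` in the collar, and that of the
original foliation elsewhere. -/
def Collar.spunTangent (c : Collar m S M) (F : Foliation m M)
    (η : ∀ s : S, TangentSpace (𝓡 m) s →L[ℝ] ℝ) (h : ℝ → ℝ) (x : M) :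
    Submodule ℝ (TangentSpace (𝓡∂ (m + 1)) x) :=
  if x ∈ c.nhd then LinearMap.ker (c.spinForm η h x).toLinearMap else F.tangent x

end Spinning

end HausdorffLeaf

end

/-!
The Hausdorff leaf space of a foliation `F` of `M` carries the largest pseudometric which is bounded
by the Riemannian distance and vanishes on pairs of points in a common leaf, and collapsing a set
only adds the requirement that it vanish on pairs of points of that set. So the two spaces to be
compared are determined by two pseudometrics on `M`, and it suffices to show that each vanishes
where the other one is required to vanish.

The foliation is changed only in the core `K = S × [0, 1/2]` of the collar, a compact set. A curve
tangent to one of the foliations is therefore tangent to the other before its first and after its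
last time in `K`, and as both pseudometrics are continuous, all that matters is that each vanishes
on `K × K` (`Foliation.eq_of_tangentCurve_of_eqOn_compl`,
`Foliation.exists_isometryEquiv_collapse`).

* For the collapsed leaf space of `F` this holds because the leaves of `F` contain the fibres of the
  collar, so that every point of `K` is in the leaf of a point of `S`
  (`Collar.tangentCurve_vertical`).
* For the spun foliation, `S` is connected and tangent to it, so that it lies in one leaf. Let `C`
  be the set of points of `K` at distance zero from a given point of `K`. It is compact, so the
  height `t` has a minimum on it. If this minimum were positive, then near a point where it is
  attained one could move along the kernel of `θ = (1 - h(t)) η + h(t) dt` to a smaller height, since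
  `1 - h(t) > 0` (`Collar.exists_tangentCurve_height_lt`). So `C` meets `S`, and `K` is sent to a
  single point of the leaf space (`Collar.eq_of_mem_core`). The asymptotic behaviour of the leaves
  near `S` does not enter.

That the spun hyperplane field is a foliation is local: in the collar `η` and `dt` are closed, so
that `dθ` is a multiple of `dt ∧ η` and `θ ∧ dθ = 0` (`Collar.frobeniusAt_spinForm`). On `S` the
kernel of `θ = dt` is the tangent space of the boundary (`Collar.ker_dt`), and the other boundary
components do not meet the collar (`Collar.height_eq_zero`).
-/

namespace HausdorffLeaf

/-! ### Chain metrics -/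

/-- The chain metric is the largest function satisfying the triangle inequality which is bounded by
`d` and vanishes on equivalent points. -/
theorem le_chainDist_classDist {X : Type*} {d D : X → X → ℝ≥0∞} (r : Setoid X)
    (htri : ∀ x y z, D x z ≤ D x y + D y z) (hd : ∀ x y, D x y ≤ d x y)
    (hr : ∀ x y, r x y → D x y = 0) (x y : X) :
    D x y ≤ chainDist (classDist d r) (Quotient.mk r x) (Quotient.mk r y) := by
  have key : ∀ (n : ℕ) (c : ℕ → Quotient r) (y : X), c 0 = Quotient.mk r x →
      c n = Quotient.mk r y → D x y ≤ ∑ i ∈ Finset.range n, classDist d r (c i) (c (i + 1)) := by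
    intro n c
    induction n with
    | zero =>
      intro y h0 hn
      rw [hr x y (Quotient.exact (h0.symm.trans hn))]
      exact bot_le
    | succ n ih =>
      intro y h0 hn
      rw [Finset.sum_range_succ]
      conv_rhs => rw [classDist]
      simp only [ENNReal.add_iInf]
      refine le_iInf fun p => le_iInf fun hp => le_iInf fun q => le_iInf fun hq => ?_
      calc D x y ≤ D x p + (D p q + D q y) := (htri x p y).trans (by gcongr; exact htri p q y)
        _ ≤ _ := by
          rw [hr q y (Quotient.exact (hq.trans hn)), add_zero]
          exact add_le_add (ih p h0 hp.symm) (hd p q)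
  exact le_iInf fun n => le_iInf fun c => le_iInf fun h0 => le_iInf fun hn => key n c y h0 hn

theorem chainDist_classDist_le {X : Type*} (d : X → X → ℝ≥0∞) (r : Setoid X) (x y : X) :
    chainDist (classDist d r) (Quotient.mk r x) (Quotient.mk r y) ≤ d x y := by
  refine (chainDist_le _ 1 (fun i => if i = 0 then Quotient.mk r x else Quotient.mk r y)
    (by simp) (by simp)).trans ?_
  simp only [Finset.range_one, Finset.sum_singleton]
  exact iInf_le_of_le x (iInf_le_of_le (by simp)
    (iInf_le_of_le y (iInf_le_of_le (by simp) le_rfl)))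

section Collapse

variable {X : Type*} [PseudoEMetricSpace X] (A : Set X)

theorem Collapse.edist_proj_le (x y : X) :
    edist (Collapse.proj A x) (Collapse.proj A y) ≤ edist x y :=
  (SeparationQuotient.edist_mk _ _).trans_le (chainDist_classDist_le edist (collapseSetoid A) x y)

theorem Collapse.proj_eq_of_mem {x y : X} (hx : x ∈ A) (hy : y ∈ A) :
    Collapse.proj A x = Collapse.proj A y :=
  congrArg SeparationQuotient.mk (Quotient.sound (s := collapseSetoid A) (Or.inr ⟨hx, hy⟩))

theorem Collapse.proj_surjective : Function.Surjective (Collapse.proj A) :=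
  SeparationQuotient.surjective_mk.comp Quotient.mk_surjective

theorem Collapse.le_edist_proj {D : X → X → ℝ≥0∞} (h0 : ∀ x, D x x = 0)
    (htri : ∀ x y z, D x z ≤ D x y + D y z) (hd : ∀ x y, D x y ≤ edist x y)
    (hA : ∀ x ∈ A, ∀ y ∈ A, D x y = 0) (x y : X) :
    D x y ≤ edist (Collapse.proj A x) (Collapse.proj A y) := by
  refine le_trans (le_chainDist_classDist (collapseSetoid A) htri hd ?_ x y)
    (SeparationQuotient.edist_mk _ _).ge
  rintro x y (rfl | ⟨hx, hy⟩)
  exacts [h0 x, hA x hx y hy]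

end Collapse

/-- Two surjections inducing the same distance have isometric targets. -/
theorem exists_isometryEquiv_of_edist_eq {X Y Z : Type*} [EMetricSpace Y] [EMetricSpace Z]
    {f : X → Y} {g : X → Z} (hf : Function.Surjective f) (hg : Function.Surjective g)
    (hfg : ∀ x y, edist (f x) (f y) = edist (g x) (g y)) :
    ∃ e : Y ≃ᵢ Z, ∀ x, e (f x) = g x := by
  have hσ := Function.surjInv_eq hf
  have hτ := Function.surjInv_eq hg
  have h1 : ∀ x, g (Function.surjInv hf (f x)) = g x := fun x => by
    rw [← edist_eq_zero, ← hfg, hσ, edist_self]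
  have h2 : ∀ x, f (Function.surjInv hg (g x)) = f x := fun x => by
    rw [← edist_eq_zero, hfg, hτ, edist_self]
  refine ⟨⟨⟨fun y => g (Function.surjInv hf y), fun z => f (Function.surjInv hg z),
    fun y => ?_, fun z => ?_⟩, fun y y' => ?_⟩, h1⟩
  · simp only [h2, hσ]
  · simp only [h1, hτ]
  · simp only [← hfg, hσ]

/-! ### The Hausdorff leaf space -/

section Leaves

variable {m : ℕ} {M : Type*} [TopologicalSpace M] [ChartedSpace (EuclideanHalfSpace (m + 1)) M]

/-- A `C¹` curve tangent to the foliation may be parametrized by any interval. -/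
theorem Foliation.tangentCurve_of_Icc (F : Foliation m M) {γ : ℝ → M} {a b : ℝ} (hab : a < b)
    (hγ : ContMDiffOn 𝓘(ℝ, ℝ) (𝓡∂ (m + 1)) 1 γ (Icc a b))
    (ht : ∀ t ∈ Icc a b,
      mfderivWithin 𝓘(ℝ, ℝ) (𝓡∂ (m + 1)) γ (Icc a b) t (1 : ℝ) ∈ F.tangent (γ t)) :
    F.TangentCurve (γ a) (γ b) := by
  have hmaps : MapsTo (fun t : ℝ => a + (b - a) * t) (Icc 0 1) (Icc a b) := by
    intro t ht
    constructor <;> nlinarith [ht.1, ht.2]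
  have hl : ContDiff ℝ 1 (fun t : ℝ => a + (b - a) * t) := by fun_prop
  refine ⟨γ ∘ fun t => a + (b - a) * t, hγ.comp hl.contMDiff.contMDiffOn hmaps, by simp,
    by simp, fun t htt => ?_⟩
  have hu : UniqueMDiffWithinAt 𝓘(ℝ, ℝ) (Icc (0 : ℝ) 1) t :=
    (uniqueDiffOn_Icc zero_lt_one t htt).uniqueMDiffWithinAt
  have hd : HasDerivWithinAt (fun t : ℝ => a + (b - a) * t) (b - a) (Icc 0 1) t := by
    simpa using (((hasDerivAt_id t).const_mul (b - a)).const_add a).hasDerivWithinAt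
  rw [mfderivWithin_comp (I' := 𝓘(ℝ, ℝ)) t ((hγ _ (hmaps htt)).mdifferentiableWithinAt one_ne_zero)
    (hl.contMDiff.contMDiffAt.mdifferentiableAt one_ne_zero).mdifferentiableWithinAt hmaps hu]
  have hd' : mfderivWithin 𝓘(ℝ, ℝ) 𝓘(ℝ, ℝ) (fun t : ℝ => a + (b - a) * t) (Icc 0 1) t (1 : ℝ)
      = (b - a) • (1 : ℝ) := by
    rw [mfderivWithin_eq_fderivWithin]
    have := hd.hasFDerivWithinAt.fderivWithin (uniqueDiffOn_Icc zero_lt_one t htt)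
    exact (congrArg (fun L : ℝ →L[ℝ] ℝ => L 1) this).trans (by simp)
  have := (F.tangent _).smul_mem (b - a) (ht _ (hmaps htt))
  rw [← (mfderivWithin 𝓘(ℝ, ℝ) (𝓡∂ (m + 1)) γ (Icc a b) (a + (b - a) * t)).map_smul (b - a)
    (1 : ℝ)] at this
  exact (congrArg (fun v : TangentSpace 𝓘(ℝ, ℝ) (a + (b - a) * t) =>
    mfderivWithin 𝓘(ℝ, ℝ) (𝓡∂ (m + 1)) γ (Icc a b) (a + (b - a) * t) v ∈
      F.tangent (γ (a + (b - a) * t))) hd').mpr this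

/-- A map which is continuous, constant on the closed set `K`, and constant on the leaves of a
foliation, is constant on the leaves of any other foliation with the same tangent spaces off `K`:
a curve in such a leaf meets `K` for a first and a last time, and before and after that
it is tangent to both foliations. -/
theorem Foliation.eq_of_tangentCurve_of_eqOn_compl {F F' : Foliation m M} {Z : Type*}
    [TopologicalSpace Z] [T2Space Z] {p : M → Z} (hp : Continuous p) {K : Set M} (hK : IsClosed K)
    (hF : ∀ x ∉ K, F.tangent x = F'.tangent x) (hpK : ∀ x ∈ K, ∀ y ∈ K, p x = p y)
    (hpF : ∀ x y, F.TangentCurve x y → p x = p y) {x y : M} (hxy : F'.TangentCurve x y) :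
    p x = p y := by
  obtain ⟨γ, hγ, rfl, rfl, ht⟩ := hxy
  have hsub : ∀ u ∈ Icc (0 : ℝ) 1, ∀ v ∈ Icc (0 : ℝ) 1, u < v → (∀ t ∈ Icc u v, γ t ∉ K) →
      p (γ u) = p (γ v) := by
    intro u hu v hv huv hm
    have hss : Icc u v ⊆ Icc 0 1 := Icc_subset_Icc hu.1 hv.2
    refine hpF _ _ (F.tangentCurve_of_Icc huv (hγ.mono hss) fun t htt => ?_)
    rw [mfderivWithin_subset hss (uniqueDiffOn_Icc huv t htt).uniqueMDiffWithinAt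
      ((hγ t (hss htt)).mdifferentiableWithinAt one_ne_zero), hF _ (hm t htt)]
    exact ht t (hss htt)
  have hcont : ContinuousOn (fun t => p (γ t)) (Icc 0 1) := hp.comp_continuousOn hγ.continuousOn
  -- by continuity, the endpoints of the interval are allowed to be sent into `K`
  have hopen : ∀ u ∈ Icc (0 : ℝ) 1, ∀ v ∈ Icc (0 : ℝ) 1, u ≤ v → (∀ t ∈ Ioo u v, γ t ∉ K) →
      p (γ u) = p (γ v) := by
    intro u hu v hv huv hm
    rcases huv.eq_or_lt with rfl | huv
    · rfl
    have hss : Icc u v ⊆ Icc 0 1 := Icc_subset_Icc hu.1 hv.2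
    have hmid : (u + v) / 2 ∈ Ioo u v := ⟨by linarith, by linarith⟩
    have hEq : EqOn (fun t => p (γ t)) (fun _ => p (γ ((u + v) / 2))) (Ioo u v) := by
      intro t htt
      have aux : ∀ s ∈ Ioo u v, ∀ s' ∈ Ioo u v, s < s' → p (γ s) = p (γ s') :=
        fun s hs s' hs' hlt => hsub s (hss (Ioo_subset_Icc_self hs)) s'
          (hss (Ioo_subset_Icc_self hs')) hlt
          fun t ht => hm t ⟨hs.1.trans_le ht.1, ht.2.trans_lt hs'.2⟩
      rcases lt_trichotomy t ((u + v) / 2) with h | h | h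
      · exact aux _ htt _ hmid h
      · exact congrArg (fun t => p (γ t)) h
      · exact (aux _ hmid _ htt h).symm
    have hEq' := hEq.of_subset_closure (hcont.mono hss) continuousOn_const Ioo_subset_Icc_self
      (closure_Ioo huv.ne).ge
    exact (hEq' (left_mem_Icc.2 huv.le)).trans (hEq' (right_mem_Icc.2 huv.le)).symm
  have h0 : (0 : ℝ) ∈ Icc (0 : ℝ) 1 := ⟨le_rfl, zero_le_one⟩
  have h1 : (1 : ℝ) ∈ Icc (0 : ℝ) 1 := ⟨zero_le_one, le_rfl⟩
  have hT : IsCompact (Icc 0 1 ∩ γ ⁻¹' K) :=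
    isCompact_Icc.of_isClosed_subset
      (hγ.continuousOn.preimage_isClosed_of_isClosed isClosed_Icc hK) inter_subset_left
  rcases (Icc 0 1 ∩ γ ⁻¹' K).eq_empty_or_nonempty with he | hne
  · exact hopen 0 h0 1 h1 zero_le_one fun t htt hm =>
      he.le ⟨Ioo_subset_Icc_self htt, hm⟩
  obtain ⟨a, ⟨haI, haK⟩, ha⟩ := hT.exists_isLeast hne
  obtain ⟨b, ⟨hbI, hbK⟩, hb⟩ := hT.exists_isGreatest hne
  calc p (γ 0) = p (γ a) := hopen 0 h0 a haI haI.1 fun t htt hm =>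
        absurd (ha ⟨⟨htt.1.le, htt.2.le.trans haI.2⟩, hm⟩) (not_le.2 htt.2)
    _ = p (γ b) := hpK _ haK _ hbK
    _ = p (γ 1) := hopen b hbI 1 h1 hbI.2 fun t htt hm =>
        absurd (hb ⟨⟨hbI.1.trans htt.1.le, htt.2.le⟩, hm⟩) (not_le.2 htt.1)

theorem Foliation.eq_of_leafSetoid {F : Foliation m M} {Z : Type*} {p : M → Z}
    (h : ∀ x y, F.TangentCurve x y → p x = p y) {x y : M} (hxy : F.leafSetoid x y) :
    p x = p y := by
  induction hxy with
  | rel x y h' => exact h x y h'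
  | refl x => rfl
  | symm x y _ ih => exact ih.symm
  | trans x y z _ _ ih ih' => exact ih.trans ih'

variable [RiemannianBundle (fun x : M => TangentSpace (𝓡∂ (m + 1)) x)]

theorem Foliation.edist_proj_le (F : Foliation m M) (x y : M) :
    edist (F.proj x) (F.proj y) ≤ riemannianEDist (𝓡∂ (m + 1)) x y :=
  (SeparationQuotient.edist_mk _ _).trans_le (chainDist_classDist_le _ F.leafSetoid x y)

theorem Foliation.proj_eq_of_tangentCurve (F : Foliation m M) {x y : M} (h : F.TangentCurve x y) :
    F.proj x = F.proj y :=
  congrArg SeparationQuotient.mk (Quotient.sound (s := F.leafSetoid) (Relation.EqvGen.rel _ _ h))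

theorem Foliation.proj_surjective (F : Foliation m M) : Function.Surjective F.proj :=
  SeparationQuotient.surjective_mk.comp Quotient.mk_surjective

theorem Foliation.le_edist_proj (F : Foliation m M) {Z : Type*} [PseudoEMetricSpace Z]
    {p : M → Z} (hd : ∀ x y, edist (p x) (p y) ≤ riemannianEDist (𝓡∂ (m + 1)) x y)
    (hF : ∀ x y, F.TangentCurve x y → p x = p y) (x y : M) :
    edist (p x) (p y) ≤ edist (F.proj x) (F.proj y) :=
  le_trans (le_chainDist_classDist (D := fun x y => edist (p x) (p y)) F.leafSetoid
    (fun _ _ _ => edist_triangle _ _ _) hd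
    (fun x y h => by simp [F.eq_of_leafSetoid hF h]) x y)
    (SeparationQuotient.edist_mk _ _).ge

variable [IsManifold (𝓡∂ (m + 1)) ∞ M]

/-- The Riemannian distance is continuous for the topology of the manifold. -/
theorem continuous_of_edist_le_riemannianEDist
    [IsContMDiffRiemannianBundle (𝓡∂ (m + 1)) ∞ (EuclideanSpace ℝ (Fin (m + 1)))
      (fun x : M => TangentSpace (𝓡∂ (m + 1)) x)] {Z : Type*} [PseudoEMetricSpace Z] {p : M → Z}
    (hd : ∀ x y, edist (p x) (p y) ≤ riemannianEDist (𝓡∂ (m + 1)) x y) : Continuous p := by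
  have : IsManifold (𝓡∂ (m + 1)) 1 M := IsManifold.of_le (n := ∞) (by simp)
  obtain ⟨g, hg, hg'⟩ := IsContMDiffRiemannianBundle.exists_contMDiff (IB := 𝓡∂ (m + 1)) (n := ∞)
    (F := EuclideanSpace ℝ (Fin (m + 1))) (E := fun x : M => TangentSpace (𝓡∂ (m + 1)) x)
  have : IsContinuousRiemannianBundle (EuclideanSpace ℝ (Fin (m + 1)))
    (fun x : M => TangentSpace (𝓡∂ (m + 1)) x) := ⟨g, hg.continuous, hg'⟩
  refine continuous_iff_continuousAt.2 fun x => EMetric.tendsto_nhds.2 fun ε hε => ?_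
  filter_upwards [eventually_riemannianEDist_lt (𝓡∂ (m + 1)) x hε] with y hy
  rw [edist_comm]
  exact (hd x y).trans_lt hy

/-- Collapsing a set `A` in the Hausdorff leaf space of `F` gives the Hausdorff leaf space of `F'`,
provided that `F` and `F'` agree off a closed set `K` containing `A`, that `K` is sent to one point
in the Hausdorff leaf space of `F'`, and that every leaf of `F` through `K` meets `A`. -/
theorem Foliation.exists_isometryEquiv_collapse
    [IsContMDiffRiemannianBundle (𝓡∂ (m + 1)) ∞ (EuclideanSpace ℝ (Fin (m + 1)))
      (fun x : M => TangentSpace (𝓡∂ (m + 1)) x)] (F F' : Foliation m M) {K A : Set M}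
    (hK : IsClosed K) (hAK : A ⊆ K) (hFF' : ∀ x ∉ K, F.tangent x = F'.tangent x)
    (hF : ∀ x ∈ K, ∃ a ∈ A, F.proj x = F.proj a) (hF' : ∀ x ∈ K, ∀ y ∈ K, F'.proj x = F'.proj y) :
    ∃ e : Collapse F.HLS (F.proj '' A) ≃ᵢ F'.HLS,
      ∀ x : M, e (Collapse.proj (F.proj '' A) (F.proj x)) = F'.proj x := by
  refine exists_isometryEquiv_of_edist_eq (f := fun x => Collapse.proj (F.proj '' A) (F.proj x))
    ((Collapse.proj_surjective _).comp F.proj_surjective) F'.proj_surjective fun x y =>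
    le_antisymm ?_ ?_
  · have hd : ∀ x y : M, edist (Collapse.proj (F.proj '' A) (F.proj x))
        (Collapse.proj (F.proj '' A) (F.proj y)) ≤ riemannianEDist (𝓡∂ (m + 1)) x y :=
      fun x y => (Collapse.edist_proj_le _ _ _).trans (F.edist_proj_le x y)
    refine F'.le_edist_proj hd (fun x y h => ?_) x y
    refine eq_of_tangentCurve_of_eqOn_compl
      (p := fun x => Collapse.proj (F.proj '' A) (F.proj x))
      (continuous_of_edist_le_riemannianEDist hd) hK hFF' (fun x hx y hy => ?_)
      (fun x y h => congrArg _ (F.proj_eq_of_tangentCurve h)) h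
    obtain ⟨a, ha, hxa⟩ := hF x hx
    obtain ⟨b, hb, hyb⟩ := hF y hy
    rw [hxa, hyb]
    exact Collapse.proj_eq_of_mem _ (mem_image_of_mem _ ha) (mem_image_of_mem _ hb)
  · have hle : ∀ x y, edist (F'.proj x) (F'.proj y) ≤ edist (F.proj x) (F.proj y) := by
      refine F.le_edist_proj F'.edist_proj_le fun x y h => ?_
      exact eq_of_tangentCurve_of_eqOn_compl (F := F')
        (continuous_of_edist_le_riemannianEDist F'.edist_proj_le) hK
        (fun x hx => (hFF' x hx).symm) hF' (fun x y h => F'.proj_eq_of_tangentCurve h) h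
    -- the distance of `F'` descends to the leaf space of `F`, where it can be compared with chains
    have hσ := Function.surjInv_eq F.proj_surjective
    set σ := Function.surjInv F.proj_surjective
    have hσ' : ∀ x, F'.proj (σ (F.proj x)) = F'.proj x := fun x => by
      rw [← edist_eq_zero, ← nonpos_iff_eq_zero]
      exact (hle _ _).trans_eq (by rw [hσ, edist_self])
    have := Collapse.le_edist_proj (F.proj '' A)
      (D := fun u v => edist (F'.proj (σ u)) (F'.proj (σ v))) (fun u => edist_self _)
      (fun _ _ _ => edist_triangle _ _ _) (fun u v => (hle _ _).trans_eq (by rw [hσ, hσ])) ?_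
      (F.proj x) (F.proj y)
    · simpa only [hσ'] using this
    · rintro _ ⟨a, ha, rfl⟩ _ ⟨b, hb, rfl⟩
      rw [hσ', hσ', hF' a (hAK ha) b (hAK hb), edist_self]

end Leaves

/-! ### Calculus of 1-forms -/

section Forms

variable {E : Type*} [NormedAddCommGroup E] [NormedSpace ℝ E] {H : Type*} [TopologicalSpace H]
  {I : ModelWithCorners ℝ E H} {M : Type*} [TopologicalSpace M] [ChartedSpace H M]
  {E' : Type*} [NormedAddCommGroup E'] [NormedSpace ℝ E'] {H' : Type*} [TopologicalSpace H']
  {J : ModelWithCorners ℝ E' H'} {N : Type*} [TopologicalSpace N] [ChartedSpace H' N]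

variable (I J) in
/-- The pullback of the 1-form `η` under `f`. -/
noncomputable def pullbackForm (f : M → N) (η : ∀ y : N, TangentSpace J y →L[ℝ] ℝ) (x : M) :
    TangentSpace I x →L[ℝ] ℝ :=
  (η (f x)).comp (mfderiv I J f x)

theorem mem_closure_interior_range_extChartAt (x : M) :
    extChartAt I x x ∈ closure (interior (range I)) :=
  I.range_subset_closure_interior (extChartAt_target_subset_range x (mem_extChartAt_target x))

theorem extChartAt_self_mem_range (x : M) : extChartAt I x x ∈ range I :=
  extChartAt_target_subset_range x (mem_extChartAt_target x)

/-- The derivative of the preferred chart at its own centre is the identity, by the definition of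
`TangentSpace`. -/
theorem formInChart_self [IsManifold I 1 M] (α : ∀ x : M, TangentSpace I x →L[ℝ] ℝ) (x : M) :
    formInChart I α x (extChartAt I x x) = α x := by
  -- all tangent spaces are `E` by definition, so forms at equal points may be compared in `E →L[ℝ] ℝ`
  have h : ∀ p, p = x → (α p : E →L[ℝ] ℝ) = α x := by
    rintro _ rfl
    rfl
  have e := mfderivWithin_range_extChartAt_symm (I := I) (x := x)
  ext v
  exact (congrArg (fun L : E →L[ℝ] ℝ => L _) (h _ (extChartAt_to_inv x))).trans
    (congrArg (fun L : E →L[ℝ] E => (α x : E →L[ℝ] ℝ) (L v)) e)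

/-- In the preferred charts at `x` and `f x`, the pullback of a form is its pullback under the
coordinate expression of `f`. -/
theorem formInChart_pullback_eventuallyEq [IsManifold I 1 M] [IsManifold J 1 N] {f : M → N} {x : M}
    (hf : ∀ᶠ y in 𝓝 x, MDifferentiableAt I J f y) (η : ∀ y : N, TangentSpace J y →L[ℝ] ℝ) :
    formInChart I (pullbackForm I J f η) x =ᶠ[𝓝[range I] (extChartAt I x x)] fun y =>
      (formInChart J η (f x) (writtenInExtChartAt I J x f y)).comp
        (fderivWithin ℝ (writtenInExtChartAt I J x f) (range I) y) := by
  have hfc : ContinuousAt f x := hf.self_of_nhds.continuousAt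
  have hev : ∀ᶠ z in 𝓝 x, MDifferentiableAt I J f z ∧ f z ∈ (extChartAt J (f x)).source :=
    hf.and (hfc.preimage_mem_nhds (extChartAt_source_mem_nhds (f x)))
  have hev0 : ∀ᶠ z' in 𝓝 ((extChartAt I x).symm (extChartAt I x x)), ∀ᶠ z in 𝓝 z',
      MDifferentiableAt I J f z ∧ f z ∈ (extChartAt J (f x)).source := by
    rw [extChartAt_to_inv]
    exact hev.eventually_nhds
  have hev' := (continuousAt_extChartAt_symm'' (mem_extChartAt_target (I := I) x)).continuousWithinAt
    (s := range I) |>.tendsto.eventually hev0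
  filter_upwards [hev', self_mem_nhdsWithin, extChartAt_target_mem_nhdsWithin x] with y hy hyI hyt
  have hyz := hy.self_of_nhds
  set z := (extChartAt I x).symm y with hz
  have d1 : HasMFDerivWithinAt 𝓘(ℝ, E) I (extChartAt I x).symm (range I) y _ :=
    (mdifferentiableWithinAt_extChartAt_symm hyt).hasMFDerivWithinAt
  have d2 : HasMFDerivWithinAt 𝓘(ℝ, E) J (f ∘ (extChartAt I x).symm) (range I) y _ :=
    hyz.1.hasMFDerivAt.comp_hasMFDerivWithinAt y d1
  have hsrc : f z ∈ (chartAt H' (f x)).source := by simpa using hyz.2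
  have d3 : MDifferentiableWithinAt 𝓘(ℝ, E) 𝓘(ℝ, E') (writtenInExtChartAt I J x f) (range I) y :=
    ((mdifferentiableAt_extChartAt (I := J) hsrc).comp_mdifferentiableWithinAt y
      d2.mdifferentiableWithinAt)
  have hB : writtenInExtChartAt I J x f y = extChartAt J (f x) (f z) := rfl
  have d4 : HasMFDerivWithinAt 𝓘(ℝ, E) J
      ((extChartAt J (f x)).symm ∘ writtenInExtChartAt I J x f) (range I) y
      ((mfderivWithin 𝓘(ℝ, E') J (extChartAt J (f x)).symm (range J)
        (writtenInExtChartAt I J x f y)).comp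
        (mfderivWithin 𝓘(ℝ, E) 𝓘(ℝ, E') (writtenInExtChartAt I J x f) (range I) y)) := by
    refine HasMFDerivWithinAt.comp y (u := range J)
      (mdifferentiableWithinAt_extChartAt_symm ?_).hasMFDerivWithinAt d3.hasMFDerivWithinAt ?_
    · rw [hB]
      exact (extChartAt J (f x)).map_source hyz.2
    · intro y' _
      exact mem_range_self _
  have d5 := d4.congr_of_eventuallyEq (f₁ := f ∘ (extChartAt I x).symm) (by
    have := (continuousAt_extChartAt_symm'' hyt).continuousWithinAt (s := range I)
      |>.tendsto.eventually hy
    filter_upwards [this] with y' hy'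
    exact ((extChartAt J (f x)).left_inv hy'.2).symm)
    ((extChartAt J (f x)).left_inv hyz.2).symm
  -- the derivative of `f` in the chart of `M`, computed directly and through the chart of `N`
  have huniq := (I.uniqueDiffOn y hyI).uniqueMDiffWithinAt.eq d2 d5
  have h : ∀ p, p = f z → (η p : E' →L[ℝ] ℝ) = η (f z) := by
    rintro _ rfl
    rfl
  ext v
  have e1 := congrArg (fun L : E →L[ℝ] E' => (η (f z) : E' →L[ℝ] ℝ) (L v)) huniq
  refine Eq.trans e1 ?_
  have e2 := h ((extChartAt J (f x)).symm (writtenInExtChartAt I J x f y))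
    ((extChartAt J (f x)).left_inv hyz.2)
  have e3 := congrArg (fun L : E' →L[ℝ] ℝ => L
    (((mfderivWithin 𝓘(ℝ, E') J (extChartAt J (f x)).symm (range J)
        (writtenInExtChartAt I J x f y)).comp
        (mfderivWithin 𝓘(ℝ, E) 𝓘(ℝ, E') (writtenInExtChartAt I J x f) (range I) y) :
          E →L[ℝ] E') v)) e2
  refine Eq.trans e3.symm ?_
  have e4 : (mfderivWithin 𝓘(ℝ, E) 𝓘(ℝ, E') (writtenInExtChartAt I J x f) (range I) y :
    E →L[ℝ] E') = fderivWithin ℝ (writtenInExtChartAt I J x f) (range I) y :=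
    mfderivWithin_eq_fderivWithin
  rw [← e4]
  rfl

theorem extDerivForm_eq {α : ∀ x : M, TangentSpace I x →L[ℝ] ℝ} {x : M} {D : E →L[ℝ] E →L[ℝ] ℝ}
    (hD : HasFDerivWithinAt (formInChart I α x) D (range I) (extChartAt I x x)) (v w : E) :
    extDerivForm I α x v w = D v w - D w v := by
  have := hD.fderivWithin (I.uniqueDiffOn _ (extChartAt_self_mem_range x))
  exact congrArg (fun L : E →L[ℝ] E →L[ℝ] ℝ => L v w - L w v) this

theorem SmoothFormAt.hasFDerivWithinAt {α : ∀ x : M, TangentSpace I x →L[ℝ] ℝ} {x : M}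
    (hα : SmoothFormAt I α x) :
    HasFDerivWithinAt (formInChart I α x)
      (fderivWithin ℝ (formInChart I α x) (range I) (extChartAt I x x)) (range I)
      (extChartAt I x x) :=
  (ContDiffWithinAt.differentiableWithinAt hα (by simp)).hasFDerivWithinAt

section Pullback

variable {f : M → N} {x : M} {η : ∀ y : N, TangentSpace J y →L[ℝ] ℝ}

theorem contDiffWithinAt_writtenInExtChartAt {n : WithTop ℕ∞} (hf : ContMDiffAt I J n f x) :
    ContDiffWithinAt ℝ n (writtenInExtChartAt I J x f) (range I) (extChartAt I x x) :=
  (contMDiffAt_iff.1 hf).2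

theorem mapsTo_writtenInExtChartAt (s : Set E) :
    MapsTo (writtenInExtChartAt I J x f) s (range J) :=
  fun _ _ => mem_range_self _

theorem writtenInExtChartAt_self :
    writtenInExtChartAt I J x f (extChartAt I x x) = extChartAt J (f x) (f x) := by
  simp [writtenInExtChartAt]

variable [IsManifold I 1 M] [IsManifold J 1 N]

theorem eventually_mdifferentiableAt (hf : ContMDiffAt I J ∞ f x) :
    ∀ᶠ y in 𝓝 x, MDifferentiableAt I J f y := by
  have h1 : ContMDiffAt I J 1 f x := hf.of_le (by simp)
  filter_upwards [(contMDiffAt_iff_contMDiffAt_nhds (by simp)).1 h1] with y hy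
  exact hy.mdifferentiableAt one_ne_zero

theorem SmoothFormAt.pullback (hf : ContMDiffAt I J ∞ f x) (hη : SmoothFormAt J η (f x)) :
    SmoothFormAt I (pullbackForm I J f η) x := by
  have hB := contDiffWithinAt_writtenInExtChartAt hf
  refine ContDiffWithinAt.congr_of_eventuallyEq ?_
    (formInChart_pullback_eventuallyEq (eventually_mdifferentiableAt hf) η)
    ((formInChart_pullback_eventuallyEq (eventually_mdifferentiableAt hf) η).self_of_nhdsWithin
      (extChartAt_self_mem_range x))
  refine ContDiffWithinAt.clm_comp ?_ (hB.fderivWithin_right I.uniqueDiffOn (by simp)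
    (extChartAt_self_mem_range x))
  rw [SmoothFormAt, ← writtenInExtChartAt_self (I := I)] at hη
  exact hη.comp _ hB (mapsTo_writtenInExtChartAt _)

/-- The exterior derivative commutes with pullback: the second derivative of the map is
symmetric. -/
theorem extDerivForm_pullback (hf : ContMDiffAt I J ∞ f x) (hη : SmoothFormAt J η (f x))
    {f' : E →L[ℝ] E'} (hf' : HasMFDerivAt I J f x f') (v w : E) :
    extDerivForm I (pullbackForm I J f η) x v w = extDerivForm J η (f x) (f' v) (f' w) := by
  have hB := contDiffWithinAt_writtenInExtChartAt hf
  have hx := extChartAt_self_mem_range (I := I) x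
  have hBy : writtenInExtChartAt I J x f (extChartAt I x x) = extChartAt J (f x) (f x) :=
    writtenInExtChartAt_self
  have hN := hη.hasFDerivWithinAt
  rw [← hBy] at hN
  have hB1 : HasFDerivWithinAt (writtenInExtChartAt I J x f) f' (range I) (extChartAt I x x) :=
    hf'.2
  have hf'B := hB1.fderivWithin (I.uniqueDiffOn _ hx)
  have hB2 := ((hB.fderivWithin_right (m := ∞) I.uniqueDiffOn (by simp) hx).differentiableWithinAt
      (by simp)).hasFDerivWithinAt
  have hNB := hN.comp _ hB1 (mapsTo_writtenInExtChartAt _)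
  have hev := formInChart_pullback_eventuallyEq (eventually_mdifferentiableAt hf) η
  have hD := (hNB.clm_comp hB2).congr_of_eventuallyEq hev (hev.self_of_nhdsWithin hx)
  have hsymm : IsSymmSndFDerivWithinAt ℝ (writtenInExtChartAt I J x f) (range I)
      (extChartAt I x x) :=
    hB.isSymmSndFDerivWithinAt
      (by rw [minSmoothness_of_isRCLikeNormedField]; exact WithTop.coe_le_coe.2 le_top)
      I.uniqueDiffOn (mem_closure_interior_range_extChartAt x) hx
  refine (extDerivForm_eq hD v w).trans ?_
  refine Eq.trans ?_ (extDerivForm_eq hη.hasFDerivWithinAt (f' v) (f' w)).symm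
  have hs := hsymm.eq v w
  simp only [_root_.add_apply, ContinuousLinearMap.comp_apply,
    ContinuousLinearMap.compL_apply, ContinuousLinearMap.flip_apply, Function.comp_apply, hf'B, hBy]
  rw [hs]
  ring

end Pullback

section Algebra

variable {α β : ∀ x : M, TangentSpace I x →L[ℝ] ℝ} {a : M → ℝ} {x : M}

theorem formInChart_add : formInChart I (fun y => α y + β y) x =
    formInChart I α x + formInChart I β x := by
  ext y v
  rfl

theorem formInChart_smul : formInChart I (fun y => a y • α y) x =
    fun y => writtenInExtChartAt I 𝓘(ℝ, ℝ) x a y • formInChart I α x y := by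
  ext y v
  rfl

theorem SmoothFormAt.add (hα : SmoothFormAt I α x) (hβ : SmoothFormAt I β x) :
    SmoothFormAt I (fun y => α y + β y) x := by
  rw [SmoothFormAt, formInChart_add]
  exact ContDiffWithinAt.add hα hβ

theorem SmoothFormAt.smul (ha : ContMDiffAt I 𝓘(ℝ, ℝ) ∞ a x) (hα : SmoothFormAt I α x) :
    SmoothFormAt I (fun y => a y • α y) x := by
  rw [SmoothFormAt, formInChart_smul]
  exact ContDiffWithinAt.smul (contDiffWithinAt_writtenInExtChartAt ha) hα

theorem extDerivForm_add (hα : SmoothFormAt I α x) (hβ : SmoothFormAt I β x)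
    (v w : E) : extDerivForm I (fun y => α y + β y) x v w =
      extDerivForm I α x v w + extDerivForm I β x v w := by
  have hD := hα.hasFDerivWithinAt.add hβ.hasFDerivWithinAt
  rw [← formInChart_add] at hD
  refine (extDerivForm_eq hD v w).trans (Eq.trans ?_ (congrArg₂ (· + ·)
    (extDerivForm_eq hα.hasFDerivWithinAt v w) (extDerivForm_eq hβ.hasFDerivWithinAt v w)).symm)
  simp only [_root_.add_apply]
  ring

theorem extDerivForm_smul [IsManifold I 1 M] (hα : SmoothFormAt I α x) {a' : E →L[ℝ] ℝ}
    (ha : HasMFDerivAt I 𝓘(ℝ, ℝ) a x a') (v w : E) :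
    extDerivForm I (fun y => a y • α y) x v w =
      a x * extDerivForm I α x v w + (a' v * (α x : E →L[ℝ] ℝ) w - a' w * (α x : E →L[ℝ] ℝ) v) := by
  have hA : HasFDerivWithinAt (writtenInExtChartAt I 𝓘(ℝ, ℝ) x a) a' (range I)
    (extChartAt I x x) := ha.2
  have hax : writtenInExtChartAt I 𝓘(ℝ, ℝ) x a (extChartAt I x x) = a x := by
    simp [writtenInExtChartAt, chartAt_self_eq]
  have key : ∀ L : E →L[ℝ] ℝ, formInChart I α x (extChartAt I x x) = L →
      extDerivForm I (fun y => a y • α y) x v w =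
        a x * extDerivForm I α x v w + (a' v * L w - a' w * L v) := by
    intro L hL
    have hD := hA.smul hα.hasFDerivWithinAt
    rw [hL, hax] at hD
    refine (extDerivForm_eq (hD.congr_of_eventuallyEq (.of_eq formInChart_smul)
      (congrFun formInChart_smul _)) v w).trans (Eq.trans ?_ (congrArg (fun t => a x * t +
        (a' v * L w - a' w * L v)) (extDerivForm_eq hα.hasFDerivWithinAt v w)).symm)
    simp only [_root_.add_apply, ContinuousLinearMap.smulRight_apply, _root_.smul_apply,
      smul_eq_mul]
    ring
  exact key _ (formInChart_self α x)

end Algebra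

section Exact

theorem formInChart_id_real (x y : ℝ) :
    formInChart 𝓘(ℝ, ℝ) (fun _ : ℝ => ContinuousLinearMap.id ℝ ℝ) x y =
      ContinuousLinearMap.id ℝ ℝ := by
  have e : (mfderivWithin 𝓘(ℝ, ℝ) 𝓘(ℝ, ℝ) (extChartAt 𝓘(ℝ, ℝ) x).symm
      (range 𝓘(ℝ, ℝ)) y : ℝ →L[ℝ] ℝ) = ContinuousLinearMap.id ℝ ℝ := by
    rw [mfderivWithin_eq_fderivWithin]
    simpa using! fderiv_id
  exact e

theorem smoothFormAt_id_real (x : ℝ) :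
    SmoothFormAt 𝓘(ℝ, ℝ) (fun _ : ℝ => ContinuousLinearMap.id ℝ ℝ) x := by
  have h := funext (formInChart_id_real x)
  exact (contDiffWithinAt_const (c := ContinuousLinearMap.id ℝ ℝ)).congr (fun y _ => congrFun h y)
    (congrFun h _)

variable [IsManifold I 1 M] {g : M → ℝ} {x : M}

theorem smoothFormAt_mfderiv (hg : ContMDiffAt I 𝓘(ℝ, ℝ) ∞ g x) :
    SmoothFormAt I (fun y => (mfderiv I 𝓘(ℝ, ℝ) g y : TangentSpace I y →L[ℝ] ℝ)) x :=
  SmoothFormAt.pullback (η := fun _ : ℝ => ContinuousLinearMap.id ℝ ℝ) hg (smoothFormAt_id_real _)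

theorem extDerivForm_mfderiv (hg : ContMDiffAt I 𝓘(ℝ, ℝ) ∞ g x) (v w : E) :
    extDerivForm I (fun y => (mfderiv I 𝓘(ℝ, ℝ) g y : TangentSpace I y →L[ℝ] ℝ)) x v w = 0 := by
  refine (extDerivForm_pullback (η := fun _ : ℝ => ContinuousLinearMap.id ℝ ℝ) hg
    (smoothFormAt_id_real _) (hg.mdifferentiableAt (by simp)).hasMFDerivAt v w).trans ?_
  have hD : HasFDerivWithinAt
      (formInChart 𝓘(ℝ, ℝ) (fun _ : ℝ => ContinuousLinearMap.id ℝ ℝ) (g x)) 0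
      (range 𝓘(ℝ, ℝ)) (extChartAt 𝓘(ℝ, ℝ) (g x) (g x)) :=
    (hasFDerivWithinAt_const (𝕜 := ℝ) (E := ℝ) (ContinuousLinearMap.id ℝ ℝ) _ _).congr_of_eventuallyEq
      (.of_eq (funext (formInChart_id_real _))) (formInChart_id_real _ _)
  exact (extDerivForm_eq hD _ _).trans (by simp)

end Exact

end Forms

/-! ### The collar -/

/-- The point `t` of the half-line `[0, ∞)`, as a point of the model half-space of dimension one;
negative numbers are sent to `0`. -/
noncomputable def toHalfLine (t : ℝ) : EuclideanHalfSpace 1 :=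
  (𝓡∂ 1).symm (EuclideanSpace.single 0 t)

theorem toHalfLine_val {t : ℝ} (ht : 0 ≤ t) : (toHalfLine t).val 0 = t := by
  have h : (EuclideanSpace.single (0 : Fin 1) t) ∈ range (𝓡∂ 1) := by
    rw [range_modelWithCornersEuclideanHalfSpace]
    simpa using! ht
  have := congrArg (fun y : EuclideanSpace ℝ (Fin 1) => y 0) ((𝓡∂ 1).right_inv h)
  simpa using! this

theorem toHalfLine_val_self (q : EuclideanHalfSpace 1) : toHalfLine (q.val 0) = q := by
  refine EuclideanHalfSpace.ext _ _ (PiLp.ext fun i => ?_)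
  rw [Subsingleton.elim i 0]
  exact toHalfLine_val q.2

theorem toHalfLine_zero : toHalfLine 0 = 0 :=
  toHalfLine_val_self 0

theorem contMDiffOn_toHalfLine {n : WithTop ℕ∞} :
    ContMDiffOn 𝓘(ℝ, ℝ) (𝓡∂ 1) n toHalfLine (Ici 0) := by
  have h : ContDiff ℝ n fun t : ℝ => EuclideanSpace.single (0 : Fin 1) t :=
    contDiff_euclidean.2 fun i => by
      rw [Subsingleton.elim i 0]
      simpa using! contDiff_id
  refine (ModelWithCorners.contMDiffOn_symm (𝓡∂ 1)).comp h.contMDiff.contMDiffOn fun t ht => ?_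
  rw [range_modelWithCornersEuclideanHalfSpace]
  simpa using! ht

theorem contMDiff_val_zero {n : WithTop ℕ∞} :
    ContMDiff (𝓡∂ 1) 𝓘(ℝ, ℝ) n fun q : EuclideanHalfSpace 1 => q.val 0 :=
  (EuclideanSpace.proj (0 : Fin 1) : EuclideanSpace ℝ (Fin 1) →L[ℝ] ℝ).contMDiff.comp
    (ModelWithCorners.contMDiff (𝓡∂ 1))

section Collar

variable {m : ℕ} {S : Type*} [TopologicalSpace S] [ChartedSpace (EuclideanSpace ℝ (Fin m)) S]
  {M : Type*} [TopologicalSpace M] [ChartedSpace (EuclideanHalfSpace (m + 1)) M]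
  (c : Collar m S M)

/-- The point of the collar with coordinates `(s, t)`, for `0 ≤ t < 1`. -/
noncomputable def Collar.pt (s : S) (t : ℝ) : M := c.diffeo (s, toHalfLine t)

theorem Collar.mem_source {s : S} {t : ℝ} (ht : t ∈ Ico 0 1) :
    (s, toHalfLine t) ∈ c.diffeo.source := by
  rw [c.source_eq]
  exact (toHalfLine_val ht.1).trans_lt ht.2

theorem Collar.pt_mem {s : S} {t : ℝ} (ht : t ∈ Ico 0 1) : c.pt s t ∈ c.nhd :=
  c.diffeo.map_source (c.mem_source ht)

theorem Collar.pt_zero (s : S) : c.pt s 0 = c.incl s := by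
  rw [pt, toHalfLine_zero, incl]

theorem Collar.base_diffeo {p : S × EuclideanHalfSpace 1} (hp : p ∈ c.diffeo.source) :
    c.base (c.diffeo p) = p.1 :=
  congrArg Prod.fst (c.diffeo.left_inv hp)

theorem Collar.height_diffeo {p : S × EuclideanHalfSpace 1} (hp : p ∈ c.diffeo.source) :
    c.height (c.diffeo p) = p.2.val 0 :=
  congrArg (fun p : S × EuclideanHalfSpace 1 => p.2.val 0) (c.diffeo.left_inv hp)

theorem Collar.base_pt {s : S} {t : ℝ} (ht : t ∈ Ico 0 1) : c.base (c.pt s t) = s :=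
  c.base_diffeo (c.mem_source ht)

theorem Collar.height_pt {s : S} {t : ℝ} (ht : t ∈ Ico 0 1) : c.height (c.pt s t) = t :=
  (c.height_diffeo (c.mem_source ht)).trans (toHalfLine_val ht.1)

theorem Collar.pt_base_height {x : M} (hx : x ∈ c.nhd) : c.pt (c.base x) (c.height x) = x := by
  rw [pt, height, toHalfLine_val_self]
  exact c.diffeo.right_inv hx

theorem Collar.height_nonneg (x : M) : 0 ≤ c.height x := (c.diffeo.invFun x).2.2

theorem Collar.height_mem {x : M} (hx : x ∈ c.nhd) : c.height x ∈ Ico 0 1 := by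
  have := c.diffeo.map_target hx
  rw [c.source_eq] at this
  exact ⟨c.height_nonneg x, this⟩

theorem Collar.isOpen_nhd : IsOpen c.nhd := c.diffeo.open_target

theorem Collar.incl_mem (s : S) : c.incl s ∈ c.nhd := by
  rw [← c.pt_zero]
  exact c.pt_mem ⟨le_rfl, zero_lt_one⟩

theorem Collar.height_incl (s : S) : c.height (c.incl s) = 0 := by
  rw [← c.pt_zero, c.height_pt ⟨le_rfl, zero_lt_one⟩]

theorem Collar.contMDiffOn_base : ContMDiffOn (𝓡∂ (m + 1)) (𝓡 m) ∞ c.base c.nhd :=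
  contMDiff_fst.comp_contMDiffOn c.diffeo.contMDiffOn_invFun

theorem Collar.contMDiffOn_height : ContMDiffOn (𝓡∂ (m + 1)) 𝓘(ℝ, ℝ) ∞ c.height c.nhd :=
  contMDiff_val_zero.comp_contMDiffOn (contMDiff_snd.comp_contMDiffOn c.diffeo.contMDiffOn_invFun)

theorem Collar.contMDiffAt_base {x : M} (hx : x ∈ c.nhd) :
    ContMDiffAt (𝓡∂ (m + 1)) (𝓡 m) ∞ c.base x :=
  c.contMDiffOn_base.contMDiffAt (c.isOpen_nhd.mem_nhds hx)

theorem Collar.contMDiffAt_height {x : M} (hx : x ∈ c.nhd) :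
    ContMDiffAt (𝓡∂ (m + 1)) 𝓘(ℝ, ℝ) ∞ c.height x :=
  c.contMDiffOn_height.contMDiffAt (c.isOpen_nhd.mem_nhds hx)

theorem Collar.hasMFDerivAt_base {x : M} (hx : x ∈ c.nhd) :
    HasMFDerivAt (𝓡∂ (m + 1)) (𝓡 m) c.base x (mfderiv (𝓡∂ (m + 1)) (𝓡 m) c.base x) :=
  ((c.contMDiffAt_base hx).mdifferentiableAt (by simp)).hasMFDerivAt

theorem Collar.hasMFDerivAt_height {x : M} (hx : x ∈ c.nhd) :
    HasMFDerivAt (𝓡∂ (m + 1)) 𝓘(ℝ, ℝ) c.height x (c.dt x) :=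
  ((c.contMDiffAt_height hx).mdifferentiableAt (by simp)).hasMFDerivAt

/-- The differentials of the two projections of the collar take arbitrary values
independently. -/
theorem Collar.exists_mfderiv_eq {x : M} (hx : x ∈ c.nhd) (u : EuclideanSpace ℝ (Fin m)) (r : ℝ) :
    ∃ v : TangentSpace (𝓡∂ (m + 1)) x,
      mfderiv (𝓡∂ (m + 1)) (𝓡 m) c.base x v = u ∧ c.dt x v = r := by
  obtain ⟨p, hp, rfl⟩ : ∃ p ∈ c.diffeo.source, c.diffeo p = x :=
    ⟨_, c.diffeo.map_target hx, c.diffeo.right_inv hx⟩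
  have hΦ : HasMFDerivAt ((𝓡 m).prod (𝓡∂ 1)) (𝓡∂ (m + 1)) c.diffeo p _ :=
    (c.diffeo.mdifferentiableAt (by simp) hp).hasMFDerivAt
  have hb := c.hasMFDerivAt_base hx
  have hh := c.hasMFDerivAt_height hx
  have h1 := (hb.comp _ hΦ).congr_of_eventuallyEq (f₁ := Prod.fst)
    (Filter.eventually_of_mem (c.diffeo.open_source.mem_nhds hp)
      fun p hp => (c.base_diffeo hp).symm)
  have h2 := (hh.comp _ hΦ).congr_of_eventuallyEq (f₁ := fun p => p.2.val 0)
    (Filter.eventually_of_mem (c.diffeo.open_source.mem_nhds hp)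
      fun p hp => (c.height_diffeo hp).symm)
  have e1 := hasMFDerivAt_unique h1 (hasMFDerivAt_fst p)
  have hv : HasMFDerivAt (𝓡∂ 1) 𝓘(ℝ, ℝ) (fun q : EuclideanHalfSpace 1 => q.val 0)
      p.2 ((EuclideanSpace.proj (0 : Fin 1) :
        EuclideanSpace ℝ (Fin 1) →L[ℝ] ℝ).comp (ContinuousLinearMap.id ℝ _)) :=
    (EuclideanSpace.proj (0 : Fin 1) : EuclideanSpace ℝ (Fin 1) →L[ℝ] ℝ).hasMFDerivAt.comp _
      ((𝓡∂ 1).hasMFDerivAt)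
  have e2 := hasMFDerivAt_unique h2 (hv.comp _ (hasMFDerivAt_snd p))
  let w : EuclideanSpace ℝ (Fin m) × EuclideanSpace ℝ (Fin 1) := (u, EuclideanSpace.single 0 r)
  refine ⟨mfderiv ((𝓡 m).prod (𝓡∂ 1)) (𝓡∂ (m + 1)) c.diffeo p w, ?_, ?_⟩
  · exact congrArg (fun L : EuclideanSpace ℝ (Fin m) × EuclideanSpace ℝ (Fin 1) →L[ℝ]
      EuclideanSpace ℝ (Fin m) => L w) e1
  · refine (congrArg (fun L : EuclideanSpace ℝ (Fin m) × EuclideanSpace ℝ (Fin 1) →L[ℝ]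
      ℝ => L w) e2).trans ?_
    have : (EuclideanSpace.single (0 : Fin 1) r) 0 = r := by simp
    exact this

theorem Collar.incl_mem_boundary (s : S) : c.incl s ∈ (𝓡∂ (m + 1)).boundary M := by
  obtain ⟨x, _, hx⟩ := c.isComponent
  exact connectedComponentIn_subset _ _ (hx ▸ mem_range_self s)

theorem Collar.incl_base {x : M} (hx : x ∈ c.nhd) (h0 : c.height x = 0) :
    c.incl (c.base x) = x := by
  rw [← c.pt_zero, ← h0, c.pt_base_height hx]

/-- A point of the collar at positive height is an interior point, as diffeomorphisms preserve the
boundary. -/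
theorem Collar.height_eq_zero {x : M} (hx : x ∈ c.nhd) (hxb : x ∈ (𝓡∂ (m + 1)).boundary M)
    [IsManifold (𝓡∂ (m + 1)) ∞ M] [IsManifold (𝓡 m) ∞ S] :
    c.height x = 0 := by
  obtain ⟨p, hp, rfl⟩ : ∃ p ∈ c.diffeo.source, c.diffeo p = x :=
    ⟨_, c.diffeo.map_target hx, c.diffeo.right_inv hx⟩
  have hloc : IsLocalDiffeomorphAt ((𝓡 m).prod (𝓡∂ 1)) (𝓡∂ (m + 1)) ∞ c.diffeo p :=
    ⟨c.diffeo, hp, eqOn_refl _ _⟩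
  have h1 := (hloc.isBoundaryPoint_iff (by simp)).2 hxb
  have h2 : p ∈ ((𝓡 m).prod (𝓡∂ 1)).boundary (S × EuclideanHalfSpace 1) := h1
  rw [ModelWithCorners.boundary_of_boundaryless_left] at h2
  have h3 : (𝓡∂ 1) p.2 ∈ frontier (range (𝓡∂ 1)) := h2.2
  rw [frontier_range_modelWithCornersEuclideanHalfSpace] at h3
  rw [c.height_diffeo hp]
  exact h3.symm

theorem extChartAt_zero_of_mem_boundary {x : M} (hx : x ∈ (𝓡∂ (m + 1)).boundary M) :
    extChartAt (𝓡∂ (m + 1)) x x 0 = 0 := by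
  have h3 : extChartAt (𝓡∂ (m + 1)) x x ∈ frontier (range (𝓡∂ (m + 1))) := hx
  rw [frontier_range_modelWithCornersEuclideanHalfSpace] at h3
  exact h3.symm

/-- On `S`, the kernel of `dt` is the tangent space of the boundary: the height function is minimal
there, so that its derivative vanishes in the directions tangent to the boundary. -/
theorem Collar.ker_dt {x : M} (hx : x ∈ c.nhd) (h0 : c.height x = 0)
    (hxb : x ∈ (𝓡∂ (m + 1)).boundary M) :
    LinearMap.ker (c.dt x).toLinearMap = boundaryTangent x := by
  have hT := c.hasMFDerivAt_height hx
  obtain ⟨T, hTdef⟩ : ∃ T : EuclideanSpace ℝ (Fin (m + 1)) →L[ℝ] ℝ, T = c.dt x := ⟨_, rfl⟩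
  obtain ⟨B, hB⟩ : ∃ B, B = writtenInExtChartAt (𝓡∂ (m + 1)) 𝓘(ℝ, ℝ) x c.height := ⟨_, rfl⟩
  obtain ⟨y, hy⟩ : ∃ y, y = extChartAt (𝓡∂ (m + 1)) x x := ⟨_, rfl⟩
  have hT' : HasFDerivWithinAt B T (range (𝓡∂ (m + 1))) y := by
    rw [hB, hy, hTdef]
    exact hT.2
  have hBnn : ∀ z, 0 ≤ B z := fun z => hB ▸ c.height_nonneg _
  have hBy : B y = 0 := by
    rw [hB, hy, writtenInExtChartAt_self]
    exact h0
  have hy0 : y 0 = 0 := hy ▸ extChartAt_zero_of_mem_boundary hxb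
  have hb : ∀ v : EuclideanSpace ℝ (Fin (m + 1)), v 0 = 0 → T v = 0 := by
    intro v hv
    have hl : HasDerivAt (fun τ : ℝ => y + τ • v) v 0 := by
      simpa using ((hasDerivAt_id (0 : ℝ)).smul_const v).const_add y
    have hmaps : MapsTo (fun τ : ℝ => y + τ • v) univ (range (𝓡∂ (m + 1))) := by
      intro τ _
      rw [range_modelWithCornersEuclideanHalfSpace]
      simp [hy0, hv]
    have hd := HasFDerivWithinAt.comp_hasDerivWithinAt (0 : ℝ) (by simpa using hT')
      hl.hasDerivWithinAt hmaps
    rw [hasDerivWithinAt_univ] at hd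
    refine IsLocalMin.hasDerivAt_eq_zero (Filter.Eventually.of_forall fun τ => ?_) hd
    simp only [Function.comp_apply, zero_smul, add_zero, hBy]
    exact hBnn _
  obtain ⟨v₀, -, hv₀⟩ := c.exists_mfderiv_eq hx 0 1
  have hv₀' : ∃ v₀ : EuclideanSpace ℝ (Fin (m + 1)), T v₀ = 1 := ⟨v₀, hTdef ▸ hv₀⟩
  have hsplit : ∀ v : EuclideanSpace ℝ (Fin (m + 1)),
      T v = v 0 * T (EuclideanSpace.single 0 1) := by
    intro v
    have := hb (v - v 0 • EuclideanSpace.single 0 1) (by simp)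
    rw [map_sub, map_smul, smul_eq_mul] at this
    linarith
  have hne : T (EuclideanSpace.single 0 1) ≠ 0 := by
    intro h
    obtain ⟨v₁, hv₁⟩ := hv₀'
    rw [hsplit, h, mul_zero] at hv₁
    exact zero_ne_one hv₁
  have hiff : ∀ v : EuclideanSpace ℝ (Fin (m + 1)), T v = 0 ↔ v 0 = 0 := by
    intro v
    rw [hsplit v]
    simp [hne]
  subst hTdef
  exact Submodule.ext fun v => hiff v

end Collar

/-! ### The spun foliation -/

section Spun

variable {m : ℕ} {S : Type*} [TopologicalSpace S] [ChartedSpace (EuclideanSpace ℝ (Fin m)) S]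
  {M : Type*} [TopologicalSpace M] [ChartedSpace (EuclideanHalfSpace (m + 1)) M]
  (c : Collar m S M) {F : Foliation m M} {η : ∀ s : S, TangentSpace (𝓡 m) s →L[ℝ] ℝ} {h : ℝ → ℝ}

/-- The coefficient of `η` in `θ` is positive off `S`. -/
theorem IsSpinningFunction.lt_one (hh : IsSpinningFunction h) {t : ℝ} (ht : t ∈ Ioo 0 1) :
    h t < 1 := by
  rcases le_total t (1 / 2) with h2 | h2
  · rw [← hh.map_zero]
    exact hh.strictAnti ⟨le_rfl, by norm_num⟩ ⟨ht.1.le, h2⟩ ht.1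
  · rw [hh.eq_zero t ⟨h2, ht.2⟩]
    exact zero_lt_one

theorem Collar.contMDiffAt_comp_height (hh : IsSpinningFunction h) {x : M} (hx : x ∈ c.nhd) :
    ContMDiffAt (𝓡∂ (m + 1)) 𝓘(ℝ, ℝ) ∞ (fun y => h (c.height y)) x :=
  (hh.smooth.contMDiffOn.comp c.contMDiffOn_height fun _ hy => c.height_mem hy).contMDiffAt
    (c.isOpen_nhd.mem_nhds hx)

/-- `d(h(t)) = h'(t) dt`. The functional `T` is `dt` at `x`, seen on the model vector space. -/
theorem Collar.exists_hasMFDerivAt_comp_height (hh : IsSpinningFunction h) {x : M}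
    (hx : x ∈ c.nhd) {T : EuclideanSpace ℝ (Fin (m + 1)) →L[ℝ] ℝ} (hT : T = c.dt x) :
    ∃ k : ℝ, HasMFDerivAt (𝓡∂ (m + 1)) 𝓘(ℝ, ℝ) (fun y => h (c.height y)) x (k • T) := by
  have h1 : HasFDerivWithinAt h (fderivWithin ℝ h (Ico 0 1) (c.height x)) (Ico 0 1) (c.height x) :=
    ((hh.smooth _ (c.height_mem hx)).differentiableWithinAt (by simp)).hasFDerivWithinAt
  have h2 : HasMFDerivWithinAt (𝓡∂ (m + 1)) 𝓘(ℝ, ℝ) c.height c.nhd x T := by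
    rw [hT]
    exact (c.hasMFDerivAt_height hx).hasMFDerivWithinAt
  have h3 := (h1.hasMFDerivWithinAt.comp x h2 fun _ hy => c.height_mem hy).hasMFDerivAt
    (c.isOpen_nhd.mem_nhds hx)
  refine ⟨fderivWithin ℝ h (Ico 0 1) (c.height x) 1, ?_⟩
  have h4 : (fderivWithin ℝ h (Ico 0 1) (c.height x)).comp T =
      (fderivWithin ℝ h (Ico 0 1) (c.height x) 1) • T := by
    ext v
    have := (fderivWithin ℝ h (Ico 0 1) (c.height x)).map_smul (T v) 1
    rw [smul_eq_mul, mul_one, smul_eq_mul, mul_comm] at this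
    exact this
  rw [← h4]
  exact h3

theorem Collar.mem_ker_spinForm_iff {x : M} (v : TangentSpace (𝓡∂ (m + 1)) x) :
    v ∈ LinearMap.ker (c.spinForm η h x).toLinearMap ↔
      (1 - h (c.height x)) * η (c.base x) (mfderiv (𝓡∂ (m + 1)) (𝓡 m) c.base x v)
        + h (c.height x) * c.dt x v = 0 :=
  Iff.rfl

theorem Collar.spinForm_ne_zero (hη : c.IsDefiningForm F η) {x : M} (hx : x ∈ c.nhd) :
    c.spinForm η h x ≠ 0 := by
  intro h0
  have hker : ∀ v : TangentSpace (𝓡∂ (m + 1)) x,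
      (1 - h (c.height x)) * η (c.base x) (mfderiv (𝓡∂ (m + 1)) (𝓡 m) c.base x v)
        + h (c.height x) * c.dt x v = 0 := fun v =>
    congrArg (fun L : TangentSpace (𝓡∂ (m + 1)) x →L[ℝ] ℝ => L v) h0
  obtain ⟨v, hv1, hv2⟩ := c.exists_mfderiv_eq hx 0 1
  have hv := hker v
  rw [hv1, hv2] at hv
  have hz : η (c.base x) (0 : EuclideanSpace ℝ (Fin m)) = 0 := (η (c.base x)).map_zero
  rw [hz, mul_zero, zero_add, mul_one] at hv
  -- so `h(t) = 0`, and then `θ` is the pullback of `η`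
  refine hη.nonsingular (c.base x) (ContinuousLinearMap.ext fun u => ?_)
  obtain ⟨w, hw1, hw2⟩ := c.exists_mfderiv_eq hx u 0
  have hw := hker w
  rw [hw1, hw2, hv, sub_zero, one_mul, mul_zero, add_zero] at hw
  exact hw

section Smooth

variable [IsManifold (𝓡∂ (m + 1)) ∞ M] [IsManifold (𝓡 m) ∞ S]

theorem Collar.smoothFormAt_spinForm (hη : c.IsDefiningForm F η) (hh : IsSpinningFunction h)
    {x : M} (hx : x ∈ c.nhd) : SmoothFormAt (𝓡∂ (m + 1)) (c.spinForm η h) x := by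
  have h1 := c.contMDiffAt_comp_height hh hx
  exact ((SmoothFormAt.pullback (c.contMDiffAt_base hx) (hη.smooth _)).smul
    (contMDiffAt_const.sub h1)).add ((smoothFormAt_mfderiv (c.contMDiffAt_height hx)).smul h1)

/-- As `η` and `dt` are closed, `dθ = -h'(t) dt ∧ η`, and `θ` is a combination of `η`
and `dt`. -/
theorem Collar.frobeniusAt_spinForm (hη : c.IsDefiningForm F η) (hh : IsSpinningFunction h)
    {x : M} (hx : x ∈ c.nhd) : FrobeniusAt (𝓡∂ (m + 1)) (c.spinForm η h) x := by
  obtain ⟨T, hT⟩ : ∃ T : EuclideanSpace ℝ (Fin (m + 1)) →L[ℝ] ℝ, T = c.dt x := ⟨_, rfl⟩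
  obtain ⟨A, hA⟩ : ∃ A : EuclideanSpace ℝ (Fin (m + 1)) →L[ℝ] ℝ,
    A = pullbackForm (𝓡∂ (m + 1)) (𝓡 m) c.base η x := ⟨_, rfl⟩
  obtain ⟨k, hk⟩ := c.exists_hasMFDerivAt_comp_height hh hx hT
  have hk' : HasMFDerivAt (𝓡∂ (m + 1)) 𝓘(ℝ, ℝ) (fun y => 1 - h (c.height y)) x (-(k • T)) := by
    have := (hasMFDerivAt_const (I := 𝓡∂ (m + 1)) (I' := 𝓘(ℝ, ℝ)) (1 : ℝ) x).sub hk
    have e0 : (0 : EuclideanSpace ℝ (Fin (m + 1)) →L[ℝ] ℝ) - k • T = -(k • T) := zero_sub _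
    rw [← e0]
    exact this
  have hs1 := SmoothFormAt.pullback (c.contMDiffAt_base hx) (hη.smooth _)
  have hs2 := smoothFormAt_mfderiv (c.contMDiffAt_height hx)
  have h1 := c.contMDiffAt_comp_height hh hx
  have hd : ∀ v w : EuclideanSpace ℝ (Fin (m + 1)),
      extDerivForm (𝓡∂ (m + 1)) (c.spinForm η h) x v w = -k * (T v * A w - T w * A v) := by
    intro v w
    refine (extDerivForm_add (hs1.smul (contMDiffAt_const.sub h1)) (hs2.smul h1) v w).trans ?_
    have e1 := extDerivForm_smul hs1 hk' v w
    have e2 := extDerivForm_smul hs2 hk v w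
    have e3 := (extDerivForm_pullback (c.contMDiffAt_base hx) (hη.smooth _)
      (c.hasMFDerivAt_base hx) v w).trans (hη.closed _ _ _)
    have e4 := extDerivForm_mfderiv (c.contMDiffAt_height hx) v w
    have hT' : (mfderiv (𝓡∂ (m + 1)) 𝓘(ℝ, ℝ) c.height x : EuclideanSpace ℝ (Fin (m + 1)) →L[ℝ] ℝ)
      = T := hT.symm
    rw [e3, ← hA] at e1
    rw [e4, hT'] at e2
    have key : (1 - h (c.height x)) * 0 + (-(k * T v) * A w - -(k * T w) * A v)
      + (h (c.height x) * 0 + (k * T v * T w - k * T w * T v)) =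
        -k * (T v * A w - T w * A v) := by ring
    exact (congrArg₂ (· + ·) e1 e2).trans key
  have hθ : ∀ v : EuclideanSpace ℝ (Fin (m + 1)), (c.spinForm η h x :
      EuclideanSpace ℝ (Fin (m + 1)) →L[ℝ] ℝ) v =
        (1 - h (c.height x)) * A v + h (c.height x) * T v := by
    intro v
    rw [hA, hT]
    rfl
  have key : ∀ u v w : EuclideanSpace ℝ (Fin (m + 1)),
      (c.spinForm η h x : EuclideanSpace ℝ (Fin (m + 1)) →L[ℝ] ℝ) u *
        extDerivForm (𝓡∂ (m + 1)) (c.spinForm η h) x v w +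
      (c.spinForm η h x : EuclideanSpace ℝ (Fin (m + 1)) →L[ℝ] ℝ) v *
        extDerivForm (𝓡∂ (m + 1)) (c.spinForm η h) x w u +
      (c.spinForm η h x : EuclideanSpace ℝ (Fin (m + 1)) →L[ℝ] ℝ) w *
        extDerivForm (𝓡∂ (m + 1)) (c.spinForm η h) x u v = 0 := by
    intro u v w
    rw [hθ, hθ, hθ, hd, hd, hd]
    ring
  exact key

end Smooth

/-- The part `S × [0, 1/2]` of the collar, where the foliation is modified. -/
def Collar.core : Set M := {x | x ∈ c.nhd ∧ c.height x ≤ 1 / 2}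

theorem Collar.isCompact_core [CompactSpace S] : IsCompact c.core := by
  have himg : c.core = (fun p : S × ℝ => c.pt p.1 p.2) '' (univ ×ˢ Icc 0 (1 / 2)) := by
    ext x
    constructor
    · rintro ⟨hx, hx'⟩
      exact ⟨(c.base x, c.height x), ⟨mem_univ _, c.height_nonneg x, hx'⟩, c.pt_base_height hx⟩
    · rintro ⟨⟨s, t⟩, ⟨-, ht⟩, rfl⟩
      have ht' : t ∈ Ico (0 : ℝ) 1 := ⟨ht.1, ht.2.trans_lt (by norm_num)⟩
      exact ⟨c.pt_mem ht', (c.height_pt ht').trans_le ht.2⟩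
  rw [himg]
  refine (isCompact_univ.prod isCompact_Icc).image_of_continuousOn ?_
  have h1 : ContinuousOn (fun p : S × ℝ => (p.1, toHalfLine p.2)) (univ ×ˢ Icc 0 (1 / 2)) :=
    continuousOn_fst.prodMk ((contMDiffOn_toHalfLine (n := 1)).continuousOn.comp continuousOn_snd
      fun p hp => hp.2.1)
  exact c.diffeo.contMDiffOn_toFun.continuousOn.comp h1 fun p hp =>
    c.mem_source ⟨hp.2.1, hp.2.2.trans_lt (by norm_num)⟩

theorem Collar.isClosed_core [CompactSpace S] [T2Space M] : IsClosed c.core :=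
  c.isCompact_core.isClosed

theorem Collar.range_incl_subset_core : range c.incl ⊆ c.core := by
  rintro _ ⟨s, rfl⟩
  exact ⟨c.incl_mem s, by rw [c.height_incl]; norm_num⟩

theorem Collar.spunTangent_of_mem {x : M} (hx : x ∈ c.nhd) :
    c.spunTangent F η h x = LinearMap.ker (c.spinForm η h x).toLinearMap :=
  if_pos hx

theorem Collar.spunTangent_of_notMem_core (hc : c.IsFoliated F) (hη : c.IsDefiningForm F η)
    (hh : IsSpinningFunction h) {x : M} (hx : x ∉ c.core) :
    c.spunTangent F η h x = F.tangent x := by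
  by_cases hxn : x ∈ c.nhd
  · have hx2 : 1 / 2 ≤ c.height x := (not_le.1 fun h' => hx ⟨hxn, h'⟩).le
    rw [c.spunTangent_of_mem hxn, hc x hxn]
    ext v
    rw [c.mem_ker_spinForm_iff, hh.eq_zero _ ⟨hx2, (c.height_mem hxn).2⟩, sub_zero, one_mul,
      zero_mul, add_zero]
    exact (hη.mem_iff _ _).symm
  · exact if_neg hxn

theorem Collar.spunTangent_incl (hh : IsSpinningFunction h) (s : S) :
    c.spunTangent F η h (c.incl s) = boundaryTangent (c.incl s) := by
  rw [c.spunTangent_of_mem (c.incl_mem s),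
    ← c.ker_dt (c.incl_mem s) (c.height_incl s) (c.incl_mem_boundary s)]
  ext v
  rw [c.mem_ker_spinForm_iff, c.height_incl, hh.map_zero, sub_self, zero_mul, zero_add, one_mul]
  rfl

variable [IsManifold (𝓡∂ (m + 1)) ∞ M] [IsManifold (𝓡 m) ∞ S] [CompactSpace S] [T2Space M]

/-- The spun foliation. It is tangent to `S`, and unchanged near the other components of the
boundary. -/
noncomputable def Collar.spunFoliation (hc : c.IsFoliated F) (hη : c.IsDefiningForm F η)
    (hh : IsSpinningFunction h) : Foliation m M where
  tangent := c.spunTangent F η h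
  integrable x := by
    by_cases hx : x ∈ c.core
    · exact ⟨c.nhd, c.isOpen_nhd, hx.1, c.spinForm η h, fun y hy =>
        ⟨c.smoothFormAt_spinForm hη hh hy, c.spinForm_ne_zero hη hy,
          c.frobeniusAt_spinForm hη hh hy, fun v => by rw [c.spunTangent_of_mem hy]; rfl⟩⟩
    · obtain ⟨U, hU, hxU, α, hα⟩ := F.integrable x
      refine ⟨U ∩ c.coreᶜ, hU.inter c.isClosed_core.isOpen_compl, ⟨hxU, hx⟩, α, fun y hy => ?_⟩
      rw [c.spunTangent_of_notMem_core hc hη hh hy.2]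
      exact hα y hy.1
  tangent_or_transverse x hx := by
    obtain ⟨x₀, hx₀, hS⟩ := c.isComponent
    have hS' : range c.incl = connectedComponentIn ((𝓡∂ (m + 1)).boundary M) x₀ := hS
    by_cases hxS : x ∈ range c.incl
    · rw [hS'] at hxS
      rw [← connectedComponentIn_eq hxS, ← hS']
      left
      rintro _ ⟨s, rfl⟩
      exact c.spunTangent_incl hh s
    · have heq : ∀ y ∈ connectedComponentIn ((𝓡∂ (m + 1)).boundary M) x,
          c.spunTangent F η h y = F.tangent y := by
        intro y hy
        refine c.spunTangent_of_notMem_core hc hη hh fun hyc => hxS ?_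
        have hy0 := c.height_eq_zero hyc.1 (connectedComponentIn_subset _ _ hy)
        have hyS : y ∈ range c.incl := ⟨_, c.incl_base hyc.1 hy0⟩
        rw [hS'] at hyS ⊢
        rw [connectedComponentIn_eq hyS, ← connectedComponentIn_eq hy]
        exact mem_connectedComponentIn hx
      exact (F.tangent_or_transverse x hx).imp (fun H y hy => (heq y hy).trans (H y hy))
        fun H y hy => by rw [heq y hy]; exact H y hy

end Spun

/-! ### Curves in the collar -/

section Curves

variable {m : ℕ} {S : Type*} [TopologicalSpace S] [ChartedSpace (EuclideanSpace ℝ (Fin m)) S]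
  {M : Type*} [TopologicalSpace M] [ChartedSpace (EuclideanHalfSpace (m + 1)) M]
  (c : Collar m S M) {F : Foliation m M} {η : ∀ s : S, TangentSpace (𝓡 m) s →L[ℝ] ℝ} {h : ℝ → ℝ}

theorem Collar.contMDiffOn_pt {σ : ℝ → S} {t : ℝ → ℝ} {I : Set ℝ}
    (hσ : ContMDiffOn 𝓘(ℝ, ℝ) (𝓡 m) 1 σ I) (ht : ContDiffOn ℝ 1 t I) (htI : MapsTo t I (Ico 0 1)) :
    ContMDiffOn 𝓘(ℝ, ℝ) (𝓡∂ (m + 1)) 1 (fun τ => c.pt (σ τ) (t τ)) I := by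
  have h1 : ContMDiffOn 𝓘(ℝ, ℝ) (𝓡∂ 1) 1 (fun τ => toHalfLine (t τ)) I :=
    contMDiffOn_toHalfLine.comp ht.contMDiffOn fun τ hτ => (htI hτ).1
  exact (c.diffeo.contMDiffOn_toFun.of_le (by simp)).comp (hσ.prodMk h1)
    fun τ hτ => c.mem_source (htI hτ)

/-- The component along `S` of the velocity of a curve in the collar. -/
theorem Collar.mfderiv_base_velocity {σ : ℝ → S} {t : ℝ → ℝ} {I : Set ℝ}
    (hσ : ContMDiffOn 𝓘(ℝ, ℝ) (𝓡 m) 1 σ I) (ht : ContDiffOn ℝ 1 t I) (htI : MapsTo t I (Ico 0 1))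
    {τ : ℝ} (hτ : τ ∈ I) (hu : UniqueDiffWithinAt ℝ I τ)
    {σ' : ℝ →L[ℝ] EuclideanSpace ℝ (Fin m)}
    (hσ' : HasMFDerivWithinAt 𝓘(ℝ, ℝ) (𝓡 m) σ I τ σ') :
    mfderiv (𝓡∂ (m + 1)) (𝓡 m) c.base (c.pt (σ τ) (t τ))
      (mfderivWithin 𝓘(ℝ, ℝ) (𝓡∂ (m + 1)) (fun τ => c.pt (σ τ) (t τ)) I τ (1 : ℝ)) = σ' 1 := by
  have hΓ := ((c.contMDiffOn_pt hσ ht htI τ hτ).mdifferentiableWithinAt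
    one_ne_zero).hasMFDerivWithinAt
  have h1 := ((c.hasMFDerivAt_base (c.pt_mem (htI hτ))).comp_hasMFDerivWithinAt τ hΓ)
  have h2 := h1.congr_mono (f₁ := σ) (fun τ' hτ' => (c.base_pt (htI hτ')).symm)
    (c.base_pt (htI hτ)).symm Subset.rfl
  exact congrArg (fun L : ℝ →L[ℝ] EuclideanSpace ℝ (Fin m) => L 1)
    (hu.uniqueMDiffWithinAt.eq h2 hσ')

/-- The vertical component of the velocity of a curve in the collar. -/
theorem Collar.dt_velocity {σ : ℝ → S} {t : ℝ → ℝ} {I : Set ℝ}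
    (hσ : ContMDiffOn 𝓘(ℝ, ℝ) (𝓡 m) 1 σ I) (ht : ContDiffOn ℝ 1 t I) (htI : MapsTo t I (Ico 0 1))
    {τ : ℝ} (hτ : τ ∈ I) (hu : UniqueDiffWithinAt ℝ I τ)
    {r : ℝ} (hr : HasDerivWithinAt t r I τ) :
    c.dt (c.pt (σ τ) (t τ))
      (mfderivWithin 𝓘(ℝ, ℝ) (𝓡∂ (m + 1)) (fun τ => c.pt (σ τ) (t τ)) I τ (1 : ℝ)) = r := by
  have hΓ := ((c.contMDiffOn_pt hσ ht htI τ hτ).mdifferentiableWithinAt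
    one_ne_zero).hasMFDerivWithinAt
  have h1 := ((c.hasMFDerivAt_height (c.pt_mem (htI hτ))).comp_hasMFDerivWithinAt τ hΓ)
  have h2 := h1.congr_mono (f₁ := t) (fun τ' hτ' => (c.height_pt (htI hτ')).symm)
    (c.height_pt (htI hτ)).symm Subset.rfl
  have h3 := hu.uniqueMDiffWithinAt.eq h2 hr.hasFDerivWithinAt.hasMFDerivWithinAt
  exact (congrArg (fun L : ℝ →L[ℝ] ℝ => L 1) h3).trans (by simp)

/-- The leaves of a foliation for which the collar is foliated contain the fibres of the
collar. -/
theorem Collar.tangentCurve_vertical (hc : c.IsFoliated F) (s : S) {t : ℝ} (ht : t ∈ Ioo 0 1) :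
    F.TangentCurve (c.incl s) (c.pt s t) := by
  have hmaps : MapsTo (fun τ : ℝ => τ) (Icc 0 t) (Ico 0 1) :=
    fun τ hτ => ⟨hτ.1, hτ.2.trans_lt ht.2⟩
  have hσ : ContMDiffOn 𝓘(ℝ, ℝ) (𝓡 m) 1 (fun _ : ℝ => s) (Icc 0 t) := contMDiffOn_const
  rw [← c.pt_zero]
  refine F.tangentCurve_of_Icc (γ := fun τ => c.pt s τ) ht.1
    (c.contMDiffOn_pt hσ contDiffOn_id hmaps) fun τ hτ => ?_
  have hv := c.mfderiv_base_velocity hσ contDiffOn_id hmaps hτ (uniqueDiffOn_Icc ht.1 τ hτ)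
    (σ' := 0) (hasMFDerivWithinAt_const ..)
  rw [hc _ (c.pt_mem (hmaps hτ))]
  refine Submodule.mem_comap.2 ?_
  exact (congrArg (fun v : EuclideanSpace ℝ (Fin m) =>
    v ∈ c.restrictTangent F (c.base (c.pt s τ))) hv).mpr (Submodule.zero_mem _)

/-- A curve in the collar on which `θ` vanishes, given in a chart of `S`. -/
theorem Collar.tangentCurve_of_chart [IsManifold (𝓡 m) ∞ S]
    (hF : ∀ x ∈ c.nhd, F.tangent x = LinearMap.ker (c.spinForm η h x).toLinearMap)
    (s₀ : S) {a b : ℝ} (hab : a < b) {y y' : ℝ → EuclideanSpace ℝ (Fin m)} {t t' : ℝ → ℝ}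
    (hy : ContDiffOn ℝ 1 y (Icc a b)) (ht : ContDiffOn ℝ 1 t (Icc a b))
    (hyI : MapsTo y (Icc a b) (extChartAt (𝓡 m) s₀).target) (htI : MapsTo t (Icc a b) (Ico 0 1))
    (hy' : ∀ τ ∈ Icc a b, HasDerivWithinAt y (y' τ) (Icc a b) τ)
    (ht' : ∀ τ ∈ Icc a b, HasDerivWithinAt t (t' τ) (Icc a b) τ)
    (hθ : ∀ τ ∈ Icc a b, (1 - h (t τ)) * formInChart (𝓡 m) η s₀ (y τ) (y' τ)
      + h (t τ) * t' τ = 0) :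
    F.TangentCurve (c.pt ((extChartAt (𝓡 m) s₀).symm (y a)) (t a))
      (c.pt ((extChartAt (𝓡 m) s₀).symm (y b)) (t b)) := by
  have hσ : ContMDiffOn 𝓘(ℝ, ℝ) (𝓡 m) 1 (fun τ => (extChartAt (𝓡 m) s₀).symm (y τ)) (Icc a b) :=
    (contMDiffOn_extChartAt_symm (n := 1) s₀).comp hy.contMDiffOn hyI
  refine F.tangentCurve_of_Icc (γ := fun τ => c.pt ((extChartAt (𝓡 m) s₀).symm (y τ)) (t τ)) hab
    (c.contMDiffOn_pt hσ ht htI) fun τ hτ => ?_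
  have hu := uniqueDiffOn_Icc hab τ hτ
  have hσ' : HasMFDerivWithinAt 𝓘(ℝ, ℝ) (𝓡 m) (fun τ => (extChartAt (𝓡 m) s₀).symm (y τ))
      (Icc a b) τ _ :=
    HasMFDerivWithinAt.comp τ
      (mdifferentiableWithinAt_extChartAt_symm (hyI hτ)).hasMFDerivWithinAt
      (hy' τ hτ).hasFDerivWithinAt.hasMFDerivWithinAt
      fun τ' hτ' => extChartAt_target_subset_range s₀ (hyI hτ')
  have e1 := c.mfderiv_base_velocity hσ ht htI hτ hu hσ'
  have e2 := c.dt_velocity hσ ht htI hτ hu (ht' τ hτ)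
  rw [hF _ (c.pt_mem (htI hτ)), c.mem_ker_spinForm_iff, e1, e2, c.height_pt (htI hτ)]
  refine Eq.trans ?_ (hθ τ hτ)
  have hη : ∀ p, p = (extChartAt (𝓡 m) s₀).symm (y τ) →
      (η p : EuclideanSpace ℝ (Fin m) →L[ℝ] ℝ) = η ((extChartAt (𝓡 m) s₀).symm (y τ)) := by
    rintro _ rfl
    rfl
  have e3 : (ContinuousLinearMap.toSpanSingleton ℝ (y' τ)) 1 = y' τ := by simp
  have e4 : (η (c.base (c.pt ((extChartAt (𝓡 m) s₀).symm (y τ)) (t τ))) :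
      EuclideanSpace ℝ (Fin m) →L[ℝ] ℝ)
        ((mfderivWithin 𝓘(ℝ, EuclideanSpace ℝ (Fin m)) (𝓡 m) (extChartAt (𝓡 m) s₀).symm
          (range (𝓡 m)) (y τ) : EuclideanSpace ℝ (Fin m) →L[ℝ] EuclideanSpace ℝ (Fin m))
            ((ContinuousLinearMap.toSpanSingleton ℝ (y' τ)) 1)) =
      formInChart (𝓡 m) η s₀ (y τ) (y' τ) := by
    rw [hη _ (c.base_pt (htI hτ)), e3]
    rfl
  exact congrArg (fun r => (1 - h (t τ)) * r + h (t τ) * t' τ) e4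

/-- Nearby points of `S` are joined by curves in `S`, and these are tangent to the kernel of `θ`. -/
theorem Collar.eventually_tangentCurve_incl [IsManifold (𝓡 m) ∞ S] (hh : IsSpinningFunction h)
    (hF : ∀ x ∈ c.nhd, F.tangent x = LinearMap.ker (c.spinForm η h x).toLinearMap) (s₀ : S) :
    ∀ᶠ s in 𝓝 s₀, F.TangentCurve (c.incl s₀) (c.incl s) := by
  obtain ⟨r, hr, hball⟩ := Metric.isOpen_iff.1 (isOpen_extChartAt_target (I := 𝓡 m) s₀) _
    (mem_extChartAt_target s₀)
  have hnear : ∀ᶠ s in 𝓝 s₀, extChartAt (𝓡 m) s₀ s ∈ Metric.ball (extChartAt (𝓡 m) s₀ s₀) r :=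
    (continuousAt_extChartAt s₀).tendsto.eventually (Metric.ball_mem_nhds _ hr)
  filter_upwards [hnear, extChartAt_source_mem_nhds (I := 𝓡 m) s₀] with s hs hsrc
  let y : ℝ → EuclideanSpace ℝ (Fin m) := fun τ =>
    extChartAt (𝓡 m) s₀ s₀ + τ • (extChartAt (𝓡 m) s₀ s - extChartAt (𝓡 m) s₀ s₀)
  have hy : ∀ τ, HasDerivAt y (extChartAt (𝓡 m) s₀ s - extChartAt (𝓡 m) s₀ s₀) τ := fun τ => by
    have := ((hasDerivAt_id τ).smul_const
      (extChartAt (𝓡 m) s₀ s - extChartAt (𝓡 m) s₀ s₀)).const_add (extChartAt (𝓡 m) s₀ s₀)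
    rw [one_smul] at this
    exact this
  have hyc : ContDiff ℝ 1 y := by
    simp only [y]
    fun_prop
  have := c.tangentCurve_of_chart hF s₀ (a := 0) (b := 1) zero_lt_one (y := y) (t := fun _ => 0)
    (t' := fun _ => 0) hyc.contDiffOn contDiffOn_const (fun τ hτ => hball
      ((convex_ball _ r).add_smul_sub_mem (Metric.mem_ball_self hr) hs hτ))
    (fun _ _ => ⟨le_rfl, zero_lt_one⟩) (fun τ _ => (hy τ).hasDerivWithinAt)
    (fun _ _ => hasDerivWithinAt_const ..) (fun τ _ => by simp [hh.map_zero])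
  simpa only [y, zero_smul, add_zero, one_smul, add_sub_cancel, extChartAt_to_inv,
    (extChartAt (𝓡 m) s₀).left_inv hsrc, c.pt_zero] using this

/-- From a point of the collar at height `0 < t < 1`, a curve on which `θ` vanishes leads to a
point of smaller height: in a chart of `S`, follow the vector field `(h(t) v, -(1 - h(t)) η(v))`,
where `v` is a constant vector with `η(v) > 0` at the starting point. -/
theorem Collar.exists_tangentCurve_height_lt [IsManifold (𝓡 m) ∞ S]
    {F₀ : Foliation m M} (hη : c.IsDefiningForm F₀ η) (hh : IsSpinningFunction h)
    (hF : ∀ x ∈ c.nhd, F.tangent x = LinearMap.ker (c.spinForm η h x).toLinearMap)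
    (s₀ : S) {t₀ : ℝ} (ht₀ : t₀ ∈ Ioo 0 1) :
    ∃ s₁, ∃ t₁ ∈ Ico 0 t₀, F.TangentCurve (c.pt s₀ t₀) (c.pt s₁ t₁) := by
  obtain ⟨N, hN⟩ : ∃ N, N = formInChart (𝓡 m) η s₀ := ⟨_, rfl⟩
  obtain ⟨y₀, hy₀⟩ : ∃ y₀, y₀ = extChartAt (𝓡 m) s₀ s₀ := ⟨_, rfl⟩
  have hNsmooth : ContDiffAt ℝ 1 N y₀ := by
    have := hη.smooth s₀
    rw [SmoothFormAt, ← hN, ← hy₀, ModelWithCorners.range_eq_univ, contDiffWithinAt_univ] at this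
    exact this.of_le (by simp)
  obtain ⟨v, hv⟩ : ∃ v, 0 < N y₀ v := by
    have hne : N y₀ ≠ 0 := by
      rw [hN, hy₀, formInChart_self]
      exact hη.nonsingular s₀
    obtain ⟨v, hv⟩ : ∃ v, N y₀ v ≠ 0 := by
      by_contra! hcon
      exact hne (ContinuousLinearMap.ext hcon)
    rcases hv.lt_or_gt with hv | hv
    · exact ⟨-v, by simpa using hv⟩
    · exact ⟨v, hv⟩
  let X : EuclideanSpace ℝ (Fin m) × ℝ → EuclideanSpace ℝ (Fin m) × ℝ :=
    fun p => (h p.2 • v, -(1 - h p.2) * N p.1 v)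
  have hhs : ContDiffAt ℝ 1 h t₀ :=
    ((hh.smooth t₀ (Ioo_subset_Ico_self ht₀)).contDiffAt (Ico_mem_nhds ht₀.1 ht₀.2)).of_le
      (by simp)
  have hX : ContDiffAt ℝ 1 X (y₀, t₀) := by
    have h1 : ContDiffAt ℝ 1 (fun p : EuclideanSpace ℝ (Fin m) × ℝ => h p.2) (y₀, t₀) :=
      ContDiffAt.comp (y₀, t₀) (f := Prod.snd) hhs contDiffAt_snd
    have h2 : ContDiffAt ℝ 1 (fun p : EuclideanSpace ℝ (Fin m) × ℝ => N p.1) (y₀, t₀) :=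
      ContDiffAt.comp (y₀, t₀) (f := Prod.fst) hNsmooth contDiffAt_fst
    exact (h1.smul contDiffAt_const).prodMk
      ((contDiffAt_const.sub h1).neg.mul (h2.clm_apply contDiffAt_const))
  obtain ⟨α, hα0, ε, hε, hα⟩ :=
    hX.exists_forall_mem_closedBall_exists_eq_forall_mem_Ioo_hasDerivAt₀ 0
  have hα0' : HasDerivAt α (X (α 0)) 0 := hα 0 (by simp [hε])
  -- near time zero, the curve stays in the chart and in the collar, and the field is smooth on it
  have hgood : ∀ᶠ p in 𝓝 (y₀, t₀), p.1 ∈ (extChartAt (𝓡 m) s₀).target ∧ p.2 ∈ Ioo (0 : ℝ) 1 ∧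
      ContDiffAt ℝ 1 X p :=
    ((continuous_fst.tendsto (y₀, t₀)).eventually
      ((isOpen_extChartAt_target s₀).mem_nhds (hy₀ ▸ mem_extChartAt_target s₀))).and
      (((continuous_snd.tendsto (y₀, t₀)).eventually (isOpen_Ioo.mem_nhds ht₀)).and
        (hX.eventually (by simp)))
  have hgood' := hα0'.continuousAt.tendsto.eventually (hα0.symm ▸ hgood)
  have hsnd : HasDerivAt (fun τ => (α τ).2) (-(1 - h t₀) * N y₀ v) 0 := by
    have := (hasFDerivAt_snd (𝕜 := ℝ) (p := α 0)).comp_hasDerivAt (0 : ℝ) hα0'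
    rw [hα0] at this
    exact this
  have hneg : -(1 - h t₀) * N y₀ v < 0 := by
    have := hh.lt_one ht₀
    nlinarith
  have hdec : ∀ᶠ τ in 𝓝[>] (0 : ℝ), (α τ).2 < t₀ := by
    have h1 := (hasDerivAt_iff_tendsto_slope.1 hsnd).eventually (gt_mem_nhds hneg)
    have h2 := nhdsWithin_mono (0 : ℝ) (fun τ (hτ : τ ∈ Ioi (0 : ℝ)) => ne_of_gt hτ) h1
    filter_upwards [h2, self_mem_nhdsWithin] with τ hτ hτ0
    have hτ0' : (0 : ℝ) < τ := hτ0
    rw [slope_def_field, hα0, sub_zero] at hτ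
    have := (div_neg_iff.1 hτ).resolve_left fun h' => absurd h'.2 (not_lt.2 hτ0'.le)
    linarith [this.1]
  obtain ⟨δ, hδ, hball⟩ := Metric.eventually_nhds_iff_ball.1 hgood'
  have hsmall : ∀ᶠ τ in 𝓝[>] (0 : ℝ), τ < min δ ε :=
    nhdsWithin_le_nhds (gt_mem_nhds (lt_min hδ hε))
  obtain ⟨b, ⟨hbdec, hbs⟩, hb0⟩ := ((hdec.and hsmall).and self_mem_nhdsWithin).exists
  have hb0' : (0 : ℝ) < b := hb0
  have hin : ∀ τ ∈ Icc 0 b, (α τ).1 ∈ (extChartAt (𝓡 m) s₀).target ∧ (α τ).2 ∈ Ioo (0 : ℝ) 1 ∧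
      ContDiffAt ℝ 1 X (α τ) := fun τ hτ => hball τ (by
    rw [Metric.mem_ball, Real.dist_eq, sub_zero, abs_of_nonneg hτ.1]
    exact hτ.2.trans_lt (hbs.trans_le (min_le_left _ _)))
  have hder : ∀ τ ∈ Icc 0 b, HasDerivWithinAt α (X (α τ)) (Icc 0 b) τ := fun τ hτ =>
    (hα τ ⟨by linarith [hτ.1], by linarith [hτ.2, hbs.trans_le (min_le_right δ ε)]⟩).hasDerivWithinAt
  have hsm : ContDiffOn ℝ 1 α (Icc 0 b) :=
    ODE.contDiffOn_enat_Icc_of_hasDerivWithinAt (n := 1) (f := fun _ => X)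
      (u := {p | ContDiffAt ℝ 1 X p})
      (fun q hq => by
        have hq' : ContDiffAt ℝ 1 X q.2 := hq.2
        exact (ContDiffAt.comp q hq' contDiffAt_snd).contDiffWithinAt) hder
      fun τ hτ => (hin τ hτ).2.2
  have key := c.tangentCurve_of_chart hF s₀ hb0' (y := fun τ => (α τ).1) (t := fun τ => (α τ).2)
    (y' := fun τ => (X (α τ)).1) (t' := fun τ => (X (α τ)).2) hsm.fst hsm.snd
    (fun τ hτ => (hin τ hτ).1) (fun τ hτ => Ioo_subset_Ico_self (hin τ hτ).2.1)
    (fun τ hτ => (hasFDerivAt_fst (𝕜 := ℝ) (p := α τ)).comp_hasDerivWithinAt τ (hder τ hτ))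
    (fun τ hτ => (hasFDerivAt_snd (𝕜 := ℝ) (p := α τ)).comp_hasDerivWithinAt τ (hder τ hτ))
    (fun τ hτ => by
      simp only [X, ← hN, map_smul, smul_eq_mul]
      ring)
  refine ⟨(extChartAt (𝓡 m) s₀).symm (α b).1, (α b).2,
    ⟨(hin b (right_mem_Icc.2 hb0'.le)).2.1.1.le, hbdec⟩, ?_⟩
  simpa only [hα0, hy₀, extChartAt_to_inv] using key

end Curves

/-! ### The Hausdorff leaf space of the spun foliation -/

section Spinning

variable {m : ℕ} {S : Type*} [TopologicalSpace S] [ChartedSpace (EuclideanSpace ℝ (Fin m)) S]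
  {M : Type*} [TopologicalSpace M] [ChartedSpace (EuclideanHalfSpace (m + 1)) M]
  (c : Collar m S M) {F : Foliation m M} {η : ∀ s : S, TangentSpace (𝓡 m) s →L[ℝ] ℝ} {h : ℝ → ℝ}

theorem Collar.continuous_incl : Continuous c.incl := by
  have h1 : Continuous fun s : S => (s, (0 : EuclideanHalfSpace 1)) := by fun_prop
  refine c.diffeo.contMDiffOn_toFun.continuousOn.comp_continuous h1 fun s => ?_
  rw [← toHalfLine_zero]
  exact c.mem_source ⟨le_rfl, zero_lt_one⟩

theorem Collar.incl_injective : Function.Injective c.incl := by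
  intro s s' hss
  have h0 : (0 : ℝ) ∈ Ico (0 : ℝ) 1 := ⟨le_rfl, zero_lt_one⟩
  rw [← c.base_pt (s := s) h0, ← c.base_pt (s := s') h0, c.pt_zero, c.pt_zero, hss]

theorem Collar.preconnectedSpace [CompactSpace S] [T2Space M] (c : Collar m S M) :
    PreconnectedSpace S := by
  obtain ⟨x, _, hx⟩ := c.isComponent
  have hx' : range c.incl = connectedComponentIn ((𝓡∂ (m + 1)).boundary M) x := hx
  refine ⟨(c.continuous_incl.isClosedEmbedding
    c.incl_injective).isInducing.isPreconnected_image.1 ?_⟩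
  rw [image_univ, hx']
  exact isPreconnected_connectedComponentIn

/-- A continuous map which is constant on the leaves of the spun foliation is constant on the
core: in the closed set of points of the core with a given image, a point of minimal height has
height zero, and `S` is contained in a single leaf. -/
theorem Collar.eq_of_mem_core [IsManifold (𝓡 m) ∞ S] [CompactSpace S] [T2Space M]
    {F₀ : Foliation m M} (hη : c.IsDefiningForm F₀ η) (hh : IsSpinningFunction h)
    (hF : ∀ x ∈ c.nhd, F.tangent x = LinearMap.ker (c.spinForm η h x).toLinearMap)
    {Z : Type*} [TopologicalSpace Z] [T1Space Z] {p : M → Z} (hp : Continuous p)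
    (hpF : ∀ x y, F.TangentCurve x y → p x = p y) {x y : M} (hx : x ∈ c.core) (hy : y ∈ c.core) :
    p x = p y := by
  have hS : ∀ s s' : S, p (c.incl s) = p (c.incl s') := by
    have := c.preconnectedSpace
    refine IsLocallyConstant.apply_eq_of_preconnectedSpace
      ((IsLocallyConstant.iff_eventually_eq _).2 fun s => ?_)
    filter_upwards [c.eventually_tangentCurve_incl hh hF s] with s' hs'
    exact (hpF _ _ hs').symm
  have hdown : ∀ x ∈ c.core, ∃ s, p x = p (c.incl s) := by
    intro x hx
    obtain ⟨z, ⟨hzc, hzp⟩, hzmin⟩ :=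
      (c.isCompact_core.inter_right (isClosed_singleton.preimage hp)).exists_isMinOn
        (⟨x, hx, rfl⟩ : (c.core ∩ p ⁻¹' {p x}).Nonempty)
        (c.contMDiffOn_height.continuousOn.mono fun z hz => hz.1.1)
    rcases (c.height_nonneg z).eq_or_lt with h0 | hpos
    · exact ⟨c.base z, by rw [c.incl_base hzc.1 h0.symm]; exact hzp.symm⟩
    · obtain ⟨s₁, t₁, ht₁, hcurve⟩ := c.exists_tangentCurve_height_lt hη hh hF (c.base z)
        (t₀ := c.height z) ⟨hpos, (c.height_mem hzc.1).2⟩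
      rw [c.pt_base_height hzc.1] at hcurve
      have ht₁' : t₁ ∈ Ico (0 : ℝ) 1 := ⟨ht₁.1, ht₁.2.trans (c.height_mem hzc.1).2⟩
      have hmem : c.pt s₁ t₁ ∈ c.core ∩ p ⁻¹' {p x} :=
        ⟨⟨c.pt_mem ht₁', by rw [c.height_pt ht₁']; exact ht₁.2.le.trans hzc.2⟩,
          (hpF _ _ hcurve).symm.trans hzp⟩
      have hle : c.height z ≤ c.height (c.pt s₁ t₁) := hzmin hmem
      rw [c.height_pt ht₁'] at hle
      exact absurd ht₁.2 (not_lt.2 hle)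
  obtain ⟨s, hs⟩ := hdown x hx
  obtain ⟨s', hs'⟩ := hdown y hy
  rw [hs, hs', hS s s']

theorem Collar.exists_proj_eq_of_mem_core
    [RiemannianBundle (fun x : M => TangentSpace (𝓡∂ (m + 1)) x)] (hc : c.IsFoliated F) {x : M}
    (hx : x ∈ c.core) : ∃ a ∈ range c.incl, F.proj x = F.proj a := by
  refine ⟨c.incl (c.base x), mem_range_self _, ?_⟩
  rcases (c.height_nonneg x).eq_or_lt with h0 | hpos
  · rw [c.incl_base hx.1 h0.symm]
  · have := F.proj_eq_of_tangentCurve (c.tangentCurve_vertical hc (c.base x)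
      ⟨hpos, (c.height_mem hx.1).2⟩)
    rw [c.pt_base_height hx.1] at this
    exact this.symm

end Spinning

end HausdorffLeaf

theorem mainTheorem9 {m : ℕ} {M : Type*} [TopologicalSpace M] [T2Space M] [CompactSpace M]
    [ChartedSpace (EuclideanHalfSpace (m + 1)) M] [IsManifold (𝓡∂ (m + 1)) ∞ M]
    [RiemannianBundle (fun x : M => TangentSpace (𝓡∂ (m + 1)) x)]
    [IsContMDiffRiemannianBundle (𝓡∂ (m + 1)) ∞ (EuclideanSpace ℝ (Fin (m + 1)))
      (fun x : M => TangentSpace (𝓡∂ (m + 1)) x)]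
    {S : Type*} [TopologicalSpace S] [CompactSpace S]
    [ChartedSpace (EuclideanSpace ℝ (Fin m)) S] [IsManifold (𝓡 m) ∞ S]
    (F : HausdorffLeaf.Foliation m M) (c : HausdorffLeaf.Collar m S M)
    (hS : c.IsTransverse F) (hc : c.IsFoliated F)
    (η : ∀ s : S, TangentSpace (𝓡 m) s →L[ℝ] ℝ) (hη : c.IsDefiningForm F η)
    (h : ℝ → ℝ) (hh : HausdorffLeaf.IsSpinningFunction h) :
    ∃ FS : HausdorffLeaf.Foliation m M, (∀ x, FS.tangent x = c.spunTangent F η h x) ∧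
      ∃ e : HausdorffLeaf.Collapse F.HLS (F.proj '' range c.incl) ≃ᵢ FS.HLS,
        ∀ x : M, e (HausdorffLeaf.Collapse.proj (F.proj '' range c.incl) (F.proj x)) =
          FS.proj x := by
  let FS := c.spunFoliation hc hη hh
  have hFS : ∀ x ∈ c.nhd, FS.tangent x = LinearMap.ker (c.spinForm η h x).toLinearMap :=
    fun x hx => c.spunTangent_of_mem hx
  refine ⟨FS, fun x => rfl, F.exists_isometryEquiv_collapse FS c.isClosed_core
    c.range_incl_subset_core (fun x hx => (c.spunTangent_of_notMem_core hc hη hh hx).symm)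
    (fun x hx => c.exists_proj_eq_of_mem_core hc hx) fun x hx y hy => ?_⟩
  exact c.eq_of_mem_core hη hh hFS
    (HausdorffLeaf.continuous_of_edist_le_riemannianEDist FS.edist_proj_le)
    (fun x y => FS.proj_eq_of_tangentCurve) hx hy
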